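/- **Definitions.** An Ising model $P$ on spins $x_1,\dots,x_n\in\{1,-1\}$ has parameters $\{w_{i,j}\}_{i<j}$ and $\{h_i\}_i$ and is the distribution $P(x)=\frac1Z\exp\bigl(\sum_{i<j}w_{i,j}x_ix_j+\sum_i h_ix_i\bigr)$ on $\{1,-1\}^n$. The TV distance of $P,Q$ on the same $n$ spins is $d_{\mathrm{TV}}(P,Q)=\frac12\sum_x|P(x)-Q(x)|$. A value $v$ is an $\varepsilon$-multiplicative approximation of $a$ if $a/(1+\varepsilon)\le v\le(1+\varepsilon)a$. A function $f$ of finitely encoded instances admits an FPRAS if there is a probabilistic Turing machine that, for every instance $x$ (of encoding length $n$) and all $\varepsilon,\delta>0$ (given to the machine as $\lceil 1/\varepsilon\rceil$, $\lceil 1/\delta\rceil$ in unary), outputs with probability at least $1-\delta$ an $\varepsilon$-multiplicative approximation of $f(x)$, and whose running time is bounded by a polynomial in $n,1/\varepsilon,1/\delta$ for all outcomes of its coins. Model parameters in instances are rational numbers in binary; outputs are floating point numbers $m\cdot2^{z}$ with $m,z\in\mathbb Z$ in binary. **Proposition.** (1) If there is an FPRAS for the function that maps two Ising models $P,Q$ (on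 the same number of spins) to $d_{\mathrm{TV}}(P,Q)$, then there is an FPRAS for the function that maps an Ising model $P$, a variable $x_k$ of it and a sign $s\in\{1,-1\}$ to the atomic marginal $\Pr_P[x_k=s]$. (2) There are constants $C,d\in\mathbb N$ such that the following holds for every Ising model $P$ with real parameters on $n$ spins, every variable $x_k$, every $s\in\{1,-1\}$, every $\varepsilon>0$ and all $W\ge0$ and $H$ with $|w_{i,j}|\le W$ and $|h_i|\le H$ for all $i,j$. Let $B=C\,(n+W+H+1/\varepsilon+1)^d$, and let $h_0,\delta$ be real numbers with $-s\,h_0\ge B$ and $\delta\ge B$. Let $P_0$ be the Ising model obtained from $P$ by adding one dummy spin $x_0$ with external field $h_0$ and coupling $0$ to every other spin, and let $Q_0$ be obtained from $P_0$ by changing the coupling of $x_0$ and $x_k$ to $\delta$. Then $d_{\mathrm{TV}}(P_0,Q_0)$ is an $\varepsilon$-multiplicative approximation of $\Pr_P[x_k=s]$. -/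

import Mathlib

noncomputable section

/-! ### Ising models -/

/-- The parameters of an Ising model on the spins `0, …, n - 1`, with values in `R`: one coupling
`w j i` for each pair `i < j`, and one external field `h j` for each spin. -/
@[ext]
structure IsingModel (R : Type) (n : ℕ) where
  w : (j : Fin n) → Fin (j : ℕ) → R
  h : Fin n → R

/-- A spin configuration; `ℤˣ = {1, -1}`. -/
abbrev SpinConfig (n : ℕ) : Type := Fin n → ℤˣ

/-- A spin as the real number `1` or `-1`. -/
def spinVal (s : ℤˣ) : ℝ := ((s : ℤ) : ℝ)

namespace IsingModel

variable {n : ℕ}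

/-- An Ising model with rational parameters, seen as one with real parameters. -/
def toReal (P : IsingModel ℚ n) : IsingModel ℝ n where
  w j i := (P.w j i : ℝ)
  h j := (P.h j : ℝ)

/-- The exponent `∑_{i < j} w_{ij} x_i x_j + ∑_i h_i x_i`. -/
def exponent (P : IsingModel ℝ n) (x : SpinConfig n) : ℝ :=
  (∑ j : Fin n, ∑ i : Fin (j : ℕ),
      P.w j i * spinVal (x ⟨i, i.isLt.trans j.isLt⟩) * spinVal (x j)) +
    ∑ j : Fin n, P.h j * spinVal (x j)

/-- The partition function `Z`. -/
def partitionFunction (P : IsingModel ℝ n) : ℝ :=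
  ∑ y : SpinConfig n, Real.exp (P.exponent y)

/-- The probability `P(x)` of the configuration `x`. -/
def prob (P : IsingModel ℝ n) (x : SpinConfig n) : ℝ :=
  Real.exp (P.exponent x) / P.partitionFunction

/-- The atomic marginal `Pr_P[x_k = s]`, for `s = ±1`. -/
def marginal (P : IsingModel ℝ n) (k : Fin n) (s : ℤˣ) : ℝ :=
  ∑ x : SpinConfig n with x k = s, P.prob x

/-- The total variation distance of two Ising models on the same spins. -/
def tvDist (P Q : IsingModel ℝ n) : ℝ :=
  (1 / 2) * ∑ x : SpinConfig n, |P.prob x - Q.prob x|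

/-- The model `P` with one new spin, which has external field `h₀` and is coupled to the spin `k`
with coupling `c` and to no other spin.  The new spin is listed last. -/
def addDummy {R : Type} [Zero R] (P : IsingModel R n) (k : Fin n) (c h₀ : R) :
    IsingModel R (n + 1) where
  w j i := if hj : (j : ℕ) < n then P.w ⟨j, hj⟩ i else if (i : ℕ) = (k : ℕ) then c else 0
  h j := if hj : (j : ℕ) < n then P.h ⟨j, hj⟩ else h₀

end IsingModel

/-- `v` is an `ε`-multiplicative approximation of `a`. -/
def IsMulApprox (ε a v : ℝ) : Prop :=
  v ∈ Set.Icc (a / (1 + ε)) ((1 + ε) * a)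

/-! ### Probabilistic Turing machines -/

/-- A probabilistic Turing machine: a (multi-stack) Turing machine with two programs, `m` and `m'`.
In every step a fair coin decides which of the two is used for that step. -/
structure ProbTM extends Turing.FinTM2 where
  m' : Λ → Turing.TM2.Stmt Γ Λ σ

namespace ProbTM

/-- A configuration: the current label (`none` once the machine has halted), the internal state
and the contents of the stacks. -/
abbrev Cfg (M : ProbTM) : Type := M.toFinTM2.Cfg

/-- The step of the machine when the coin shows `b`; a halted configuration stays as it is. -/
def coinStep (M : ProbTM) (b : Bool) (c : M.Cfg) : M.Cfg :=
  (Turing.TM2.step (if b then M.m else M.m') c).getD c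

/-- The distribution of the configuration after one step. -/
def step (M : ProbTM) (c : M.Cfg) : PMF M.Cfg :=
  (PMF.uniformOfFintype Bool).map fun b => M.coinStep b c

/-- The distribution of the configuration after `t` steps, with independent coins. -/
def run (M : ProbTM) : ℕ → M.Cfg → PMF M.Cfg
  | 0, c => PMF.pure c
  | t + 1, c => (M.step c).bind (M.run t)

end ProbTM

/-! ### Words -/

/-- The alphabet used for instances and for output values. -/
inductive Symb
  | bit (b : Bool)
  | minus
  | slash
  | comma
  | semicolon
  | bar
  deriving DecidableEq, Fintype

/-- Binary notation (least significant bit first, no leading zeros, `0` is the empty word). -/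
def encNat (k : ℕ) : List Symb := (Computability.encodeNat k).map Symb.bit

/-- Sign (absent for nonnegative numbers) and binary absolute value. -/
def encInt (z : ℤ) : List Symb := (if z < 0 then [Symb.minus] else []) ++ encNat z.natAbs

/-- Reduced fraction. -/
def encRat (q : ℚ) : List Symb := encInt q.num ++ Symb.slash :: encNat q.den

/-- A list, every entry being followed by the symbol `c`. -/
def encList {α : Type} (c : Symb) (enc : α → List Symb) (l : List α) : List Symb :=
  l.flatMap fun a => enc a ++ [c]

/-- The floating point number `m * 2 ^ e`, with `m` and `e` in binary. -/
def encFloat (m e : ℤ) : List Symb := encInt m ++ Symb.comma :: encInt e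

namespace IsingModel

/-- The parameters row by row: row `j` is `w_{0j}, …, w_{j-1,j}, h_j`. -/
def rows {R : Type} {n : ℕ} (P : IsingModel R n) : List (List R) :=
  List.ofFn fun j => List.ofFn (P.w j) ++ [P.h j]

/-- The word of a model: all parameters, as binary rational numbers, row by row. -/
def word {n : ℕ} (P : IsingModel ℚ n) : List Symb :=
  encList Symb.semicolon (encList Symb.comma encRat) P.rows

end IsingModel

/-- Two Ising models with rational parameters on the same spins. -/
abbrev TVInstance : Type := Σ n : ℕ, IsingModel ℚ n × IsingModel ℚ n

/-- An Ising model with rational parameters, one of its spins `k`, and a sign. -/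
abbrev MarginalInstance : Type := Σ n : ℕ, IsingModel ℚ n × Fin n × ℤˣ

/-- The word of a pair of models: `P|Q`. -/
def tvWord (a : TVInstance) : List Symb :=
  a.2.1.word ++ Symb.bar :: a.2.2.word

/-- The word of a marginal: the sign, the index `k` in unary, and the model. -/
def marginalWord (a : MarginalInstance) : List Symb :=
  Symb.bit (decide (a.2.2.2 = 1)) :: List.replicate a.2.2.1 (Symb.bit true) ++
    Symb.bar :: a.2.1.word

/-! Different instances have different words. -/

theorem split_unique {c : Symb} {u u' t t' : List Symb} (hu : c ∉ u) (hu' : c ∉ u')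
    (h : u ++ c :: t = u' ++ c :: t') : u = u' ∧ t = t' := by
  induction u generalizing u' with
  | nil =>
    cases u' with
    | nil => exact ⟨rfl, (List.cons.inj h).2⟩
    | cons b u' =>
      rw [(List.cons.inj h).1] at hu'
      exact absurd List.mem_cons_self hu'
  | cons a u ih =>
    cases u' with
    | nil =>
      rw [← (List.cons.inj h).1] at hu
      exact absurd List.mem_cons_self hu
    | cons b u' =>
      simp only [List.cons_append, List.cons.injEq, List.mem_cons, not_or] at h hu hu'
      obtain ⟨h1, h2⟩ := ih hu.2 hu'.2 h.2
      exact ⟨by rw [h.1, h1], h2⟩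

theorem encNat_injective : Function.Injective encNat := by
  intro a b hab
  have h : Computability.encodeNat a = Computability.encodeNat b :=
    List.map_injective_iff.2 (fun x y hxy => by simpa using hxy) hab
  simpa using congrArg Computability.decodeNat h

theorem mem_encNat {k : ℕ} {c : Symb} (h : c ∈ encNat k) : ∃ b, c = Symb.bit b := by
  simp only [encNat, List.mem_map] at h
  obtain ⟨b, -, rfl⟩ := h
  exact ⟨b, rfl⟩

theorem minus_notMem_encNat (k : ℕ) : Symb.minus ∉ encNat k := fun h => by
  obtain ⟨b, hb⟩ := mem_encNat h
  cases hb

theorem mem_encInt {z : ℤ} {c : Symb} (h : c ∈ encInt z) : c = Symb.minus ∨ ∃ b, c = Symb.bit b := by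
  simp only [encInt, List.mem_append] at h
  rcases h with h | h
  · left
    split_ifs at h <;> simp_all
  · exact Or.inr (mem_encNat h)

theorem encInt_injective : Function.Injective encInt := by
  intro a b hab
  unfold encInt at hab
  by_cases ha : a < 0 <;> by_cases hb : b < 0
  · have := encNat_injective (by simpa [ha, hb] using hab)
    omega
  · have h1 : Symb.minus ∈ encNat b.natAbs := by
      simp only [ha, hb, if_true, if_false, List.nil_append] at hab
      rw [← hab]
      simp
    exact absurd h1 (minus_notMem_encNat _)
  · have h1 : Symb.minus ∈ encNat a.natAbs := by
      simp only [ha, hb, if_true, if_false, List.nil_append] at hab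
      rw [hab]
      simp
    exact absurd h1 (minus_notMem_encNat _)
  · have := encNat_injective (by simpa [ha, hb] using hab)
    omega

theorem slash_notMem_encInt (z : ℤ) : Symb.slash ∉ encInt z := fun h => by
  rcases mem_encInt h with h | ⟨b, h⟩ <;> cases h

theorem comma_notMem_encInt (z : ℤ) : Symb.comma ∉ encInt z := fun h => by
  rcases mem_encInt h with h | ⟨b, h⟩ <;> cases h

theorem mem_encRat {q : ℚ} {c : Symb} (h : c ∈ encRat q) :
    c ≠ Symb.comma ∧ c ≠ Symb.semicolon ∧ c ≠ Symb.bar := by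
  simp only [encRat, List.mem_append, List.mem_cons] at h
  rcases h with h | h | h
  · rcases mem_encInt h with rfl | ⟨b, rfl⟩ <;> simp
  · subst h
    simp
  · obtain ⟨b, rfl⟩ := mem_encNat h
    simp

theorem encRat_injective : Function.Injective encRat := by
  intro p q hpq
  obtain ⟨h1, h2⟩ := split_unique (slash_notMem_encInt _) (slash_notMem_encInt _) hpq
  exact Rat.ext (encInt_injective h1) (encNat_injective h2)

theorem encFloat_injective {m e m' e' : ℤ} (h : encFloat m e = encFloat m' e') :
    m = m' ∧ e = e' := by
  obtain ⟨h1, h2⟩ := split_unique (comma_notMem_encInt _) (comma_notMem_encInt _) h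
  exact ⟨encInt_injective h1, encInt_injective h2⟩

theorem encList_injective {α : Type} {c : Symb} {enc : α → List Symb}
    (hinj : Function.Injective enc) (hc : ∀ a, c ∉ enc a) :
    Function.Injective (encList c enc) := by
  intro l
  induction l with
  | nil =>
    intro l' h
    cases l' with
    | nil => rfl
    | cons b l' => simp [encList] at h
  | cons a l ih =>
    intro l' h
    cases l' with
    | nil => simp [encList] at h
    | cons b l' =>
      simp only [encList, List.flatMap_cons, List.append_assoc, List.singleton_append] at h
      obtain ⟨h1, h2⟩ := split_unique (hc a) (hc b) h
      rw [hinj h1, ih h2]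

theorem mem_encList {α : Type} {c d : Symb} {enc : α → List Symb} {l : List α}
    (h : d ∈ encList c enc l) : d = c ∨ ∃ a, d ∈ enc a := by
  simp only [encList, List.mem_flatMap, List.mem_append, List.mem_singleton] at h
  obtain ⟨a, -, h | h⟩ := h
  · exact Or.inr ⟨a, h⟩
  · exact Or.inl h

theorem mem_row {l : List ℚ} {d : Symb} (h : d ∈ encList Symb.comma encRat l) :
    d ≠ Symb.semicolon ∧ d ≠ Symb.bar := by
  rcases mem_encList h with rfl | ⟨q, hq⟩
  · simp
  · exact (mem_encRat hq).2

theorem bar_notMem_word {n : ℕ} (P : IsingModel ℚ n) : Symb.bar ∉ P.word := fun h => by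
  rcases mem_encList h with h | ⟨l, hl⟩
  · cases h
  · exact (mem_row hl).2 rfl

theorem rows_eq_of_word_eq {n m : ℕ} {P : IsingModel ℚ n} {Q : IsingModel ℚ m}
    (h : P.word = Q.word) : P.rows = Q.rows :=
  encList_injective (encList_injective encRat_injective fun _ hq => (mem_encRat hq).1 rfl)
    (fun _ hl => (mem_row hl).1 rfl) h

theorem size_eq_of_word_eq {n m : ℕ} {P : IsingModel ℚ n} {Q : IsingModel ℚ m}
    (h : P.word = Q.word) : n = m := by
  simpa [IsingModel.rows] using congrArg List.length (rows_eq_of_word_eq h)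

theorem word_injective {n : ℕ} :
    Function.Injective (IsingModel.word : IsingModel ℚ n → List Symb) := by
  intro P Q h
  have h1 := List.ofFn_injective (rows_eq_of_word_eq h)
  have h2 : ∀ j, P.w j = Q.w j ∧ P.h j = Q.h j := fun j => by
    have h3 := List.append_inj (congrFun h1 j) (by simp)
    exact ⟨List.ofFn_injective h3.1, by simpa using h3.2⟩
  ext j
  · exact congrFun (h2 j).1 _
  · exact (h2 j).2

theorem tvWord_injective : Function.Injective tvWord := by
  rintro ⟨n, P, Q⟩ ⟨m, P', Q'⟩ h
  obtain ⟨h1, h2⟩ := split_unique (bar_notMem_word P) (bar_notMem_word P') h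
  obtain rfl : n = m := size_eq_of_word_eq h1
  obtain rfl : P = P' := word_injective h1
  obtain rfl : Q = Q' := word_injective h2
  rfl

theorem marginalWord_injective : Function.Injective marginalWord := by
  rintro ⟨n, P, k, s⟩ ⟨m, P', k', s'⟩ h
  have hb : ∀ (b : Bool) (l : ℕ), Symb.bar ∉ Symb.bit b :: List.replicate l (Symb.bit true) := by
    intro b l
    simp [List.mem_replicate]
  obtain ⟨h1, h2⟩ := split_unique (hb _ _) (hb _ _) h
  obtain rfl : n = m := size_eq_of_word_eq h2
  obtain rfl : P = P' := word_injective h2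
  obtain ⟨h3, h4⟩ := List.cons_eq_cons.1 h1
  obtain rfl : k = k' := Fin.ext (by simpa using congrArg List.length h4)
  obtain rfl : s = s' := by
    rcases Int.units_eq_one_or s with rfl | rfl <;>
      rcases Int.units_eq_one_or s' with rfl | rfl <;> simp_all
  rfl

open Classical in
/-- The encoding with a given injective encoding function. -/
def encodingOfInjective {α Γ : Type} (enc : α → List Γ) (h : Function.Injective enc) :
    Computability.Encoding α Γ where
  encode := enc
  decode l := if hl : ∃ a, enc a = l then some hl.choose else none
  decode_encode a := by
    have hl : ∃ a', enc a' = enc a := ⟨a, rfl⟩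
    rw [dif_pos hl, h hl.choose_spec]

def tvEncoding : Computability.Encoding TVInstance Symb :=
  encodingOfInjective tvWord tvWord_injective

def marginalEncoding : Computability.Encoding MarginalInstance Symb :=
  encodingOfInjective marginalWord marginalWord_injective

/-! ### Randomized approximation schemes -/

/-- The input word of an approximation scheme: `⌈1/ε⌉` and `⌈1/δ⌉` in unary, then the instance. -/
def schemeInput {Γ : Type} (ε δ : ℝ) (x : List Γ) : List (Γ ⊕ Bool) :=
  List.replicate ⌈1 / ε⌉₊ (Sum.inr true) ++ List.replicate ⌈1 / δ⌉₊ (Sum.inr false) ++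
    x.map Sum.inl

/-- `f` admits a fully polynomial-time randomized approximation scheme, with respect to the encoding
`e` of its arguments: there is a probabilistic Turing machine which, on every `x` and all
`ε, δ > 0`, halts (for every outcome of the coins) within a number of steps that is polynomial in
the length of `x`, in `1/ε` and in `1/δ`, and which outputs, with probability at least `1 - δ`, an
`ε`-multiplicative approximation of `f x`, as a floating point number. -/
def HasFPRAS {α Γ : Type} (e : Computability.Encoding α Γ) (f : α → ℝ) : Prop :=
  ∃ (M : ProbTM) (inp : M.Γ M.k₀ ≃ Γ ⊕ Bool) (out : M.Γ M.k₁ ≃ Symb) (C d : ℕ),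
    ∀ (x : α) (ε δ : ℝ), 0 < ε → 0 < δ →
      ∃ T : ℕ,
        (T : ℝ) ≤ C * ((e.encode x).length + 1 / ε + 1 / δ + 1) ^ d ∧
        (∀ c ∈ (M.run T (Turing.initList M.toFinTM2
            ((schemeInput ε δ (e.encode x)).map inp.symm))).support, c.l = none) ∧
        ENNReal.ofReal (1 - δ) ≤
          (M.run T (Turing.initList M.toFinTM2
            ((schemeInput ε δ (e.encode x)).map inp.symm))).toOuterMeasure
            {c | ∃ m z : ℤ, (c.stk M.k₁).map out = encFloat m z ∧
              IsMulApprox ε (f x) ((m : ℝ) * (2 : ℝ) ^ z)}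

/-- The total variation distance between two Ising models, as a computational problem. -/
def tvProblem (a : TVInstance) : ℝ := a.2.1.toReal.tvDist a.2.2.toReal

/-- The atomic marginals of an Ising model, as a computational problem. -/
def marginalProblem (a : MarginalInstance) : ℝ := a.2.1.toReal.marginal a.2.2.1 a.2.2.2

end

noncomputable section

/-! ### The total variation distance after adding a dummy spin -/

/-! Write `p` and `q` for the probabilities that `x_k = s` and `x_k = -s`, and put `r = exp (2 s
h₀)`, `u = exp (-2 δ)`. Both are tiny. A field of sign `-s` makes the uncoupled dummy spin almost
surely `-s`, so `P₀` is nearly `P` with a constant spin appended. A strong coupling forces `x_k` to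
agree with the dummy spin, so `Q₀` is nearly `P` conditioned on `x_k = -s`. The distance between `P`
and this conditional law is exactly `p`.

Quantitatively, the weights of the dummy spin depend on `x` only through `x_k`, so the distance is
an explicit expression in `p, q, r, u` (`tvDist_addDummy`). It lies between `p - p (r + u) / q` and
`p + r` (`le_tv_of_mul_eq_one`, `tv_le_of_mul_eq_one`). Flipping all spins changes the exponent by a
bounded amount, so `p` and `q` are at least exponentially small (`le_marginal`). A field and a
coupling that are polynomially large make `r` and `u` smaller still, and the additive errors become
multiplicative.

For the FPRAS the new parameters are `0` and `± 2 ^ m`, with `m` linear in the input length. Such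
numbers are written without any arithmetic: `m` zero bits, then a one. The dummy spin comes last, so
the old rows are copied and one row is appended. A deterministic stack program (`prog_steps`)
therefore produces the TV instance in linear time, and `run_precomp` puts this program in front of
the given machine without altering its output distribution. Accuracy `1 / (3 a)` with `a = ⌈1/ε⌉`
leaves room for both the error of the reduction and that of the machine. -/

theorem sum_units (s : ℤˣ) (f : ℤˣ → ℝ) : ∑ t, f t = f s + f (-s) := by
  have h : (Finset.univ : Finset ℤˣ) = {1, -1} := rfl
  rw [h, Finset.sum_pair (by decide)]
  rcases Int.units_eq_one_or s with rfl | rfl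
  · rfl
  · rw [neg_neg, add_comm]

theorem spinVal_neg (s : ℤˣ) : spinVal (-s) = -spinVal s := by
  simp [spinVal]

theorem spinVal_mul_self (s : ℤˣ) : spinVal s * spinVal s = 1 := by
  rcases Int.units_eq_one_or s with rfl | rfl <;> simp [spinVal]

theorem abs_spinVal (s : ℤˣ) : |spinVal s| = 1 := by
  rcases Int.units_eq_one_or s with rfl | rfl <;> simp [spinVal]

/-- Test the two laws on the event `x_k = s`: it has mass `p` under `P₀` and `p I (r + u)` under
`Q₀`, and `I ≤ 1 / q`. Here `A` and `I` are the normalising factors of the two models. -/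
theorem le_tv_of_mul_eq_one {p q r u A I : ℝ} (hp : 0 < p) (hq : 0 < q) (hpq : p + q = 1)
    (hr : 0 ≤ r) (hu : 0 ≤ u) (hA : A * (1 + r) = 1) (hI : I * (p * (r + u) + q * (u * r + 1)) = 1) :
    p - p * ((r + u) / q) ≤ 1 / 2 * (p * (|A * r - I * r| + |A - I * u|) +
      q * (|A * r - I * (u * r)| + |A - I|)) := by
  have hI0 : 0 < I := by
    by_contra h
    have : I * (p * (r + u) + q * (u * r + 1)) ≤ 0 :=
      mul_nonpos_of_nonpos_of_nonneg (not_lt.1 h) (by positivity)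
    linarith
  have hIq : I * q ≤ 1 := by
    have h1 : 0 ≤ I * (p * (r + u) + q * (u * r)) := by positivity
    linarith
  have h2 : I * (r + u) ≤ (r + u) / q := by
    rw [le_div_iff₀ hq]
    nlinarith [mul_le_mul_of_nonneg_right hIq (add_nonneg hr hu)]
  have h3 := mul_le_mul_of_nonneg_left h2 hp.le
  have h4 := mul_le_mul_of_nonneg_left (add_le_add (le_abs_self (A * r - I * r))
    (le_abs_self (A - I * u))) hp.le
  have h5 := mul_le_mul_of_nonneg_left (add_le_add (neg_abs_le (A * r - I * (u * r)))
    (neg_abs_le (A - I))) hq.le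
  have h6 : p * (A * (1 + r)) = p := by rw [hA, mul_one]
  have h7 : q * (A * (1 + r)) = q := by rw [hA, mul_one]
  linarith

/-- Since `u ≤ 1`, the normalisers satisfy `A ≤ I`, which settles two of the four signs; the other
two terms are bounded by the triangle inequality. By the normalisations the result collapses to `p +
A r (1 - 2 p)`. -/
theorem tv_le_of_mul_eq_one {p q r u A I : ℝ} (hp : 0 < p) (hq : 0 < q) (hpq : p + q = 1)
    (hr : 0 ≤ r) (hu : 0 ≤ u) (hu' : u ≤ 1) (hA : A * (1 + r) = 1)
    (hI : I * (p * (r + u) + q * (u * r + 1)) = 1) :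
    1 / 2 * (p * (|A * r - I * r| + |A - I * u|) +
      q * (|A * r - I * (u * r)| + |A - I|)) ≤ p + r := by
  have hD : 0 < p * (r + u) + q * (u * r + 1) := by positivity
  have hA' : A = 1 / (1 + r) := by
    rw [eq_div_iff (by positivity), hA]
  have hI' : I = 1 / (p * (r + u) + q * (u * r + 1)) := by
    rw [eq_div_iff hD.ne', hI]
  have hA0 : 0 < A := by
    rw [hA']
    positivity
  have hI0 : 0 < I := by
    rw [hI']
    positivity
  have hAI : A ≤ I := by
    rw [hA', hI']
    refine one_div_le_one_div_of_le hD ?_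
    have h1 : 0 ≤ p * (1 - u) := mul_nonneg hp.le (by linarith)
    have h2 : 0 ≤ q * (r * (1 - u)) := mul_nonneg hq.le (mul_nonneg hr (by linarith))
    have h3 : (p + q) * (1 + r) = 1 + r := by rw [hpq, one_mul]
    linarith
  have e1 : |A * r - I * r| = I * r - A * r := by
    rw [abs_sub_comm, abs_of_nonneg]
    nlinarith
  have e2 : |A - I * u| ≤ A + I * u := by
    refine (abs_sub _ _).trans_eq ?_
    rw [abs_of_pos hA0, abs_of_nonneg (by positivity)]
  have e3 : |A * r - I * (u * r)| ≤ A * r + I * (u * r) := by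
    refine (abs_sub _ _).trans_eq ?_
    rw [abs_of_nonneg (by positivity), abs_of_nonneg (by positivity)]
  have e4 : |A - I| = I - A := by
    rw [abs_sub_comm, abs_of_nonneg (by linarith)]
  have h1 := mul_le_mul_of_nonneg_left (add_le_add e1.le e2) hp.le
  have h2 := mul_le_mul_of_nonneg_left (add_le_add e3 e4.le) hq.le
  have hq' : q = 1 - p := by linarith
  have hAr : A * r ≤ r := by
    have : A ≤ 1 := by nlinarith
    nlinarith
  have h6 : p * (A * (1 + r)) = p := by rw [hA, mul_one]
  have h7 : 0 ≤ p * (A * r) := by positivity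
  -- The terms in `I` add up to `1` by `hI`, and `A = 1 - A r`; what remains is `A r (1 - 2 p) ≤ r`.
  subst hq'
  nlinarith

/-! ### Marginals of an Ising model and the law of the dummy spin. -/

namespace IsingModel

variable {n : ℕ} (P : IsingModel ℝ n)

theorem partitionFunction_pos : 0 < P.partitionFunction :=
  Finset.sum_pos (fun _ _ => Real.exp_pos _) Finset.univ_nonempty

theorem prob_pos (x : SpinConfig n) : 0 < P.prob x :=
  div_pos (Real.exp_pos _) P.partitionFunction_pos

theorem exp_exponent (x : SpinConfig n) :
    Real.exp (P.exponent x) = P.prob x * P.partitionFunction :=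
  (div_mul_cancel₀ _ P.partitionFunction_pos.ne').symm

theorem sum_prob : ∑ x, P.prob x = 1 := by
  simp only [prob]
  rw [← Finset.sum_div]
  exact div_self P.partitionFunction_pos.ne'

theorem marginal_nonneg (k : Fin n) (s : ℤˣ) : 0 ≤ P.marginal k s :=
  Finset.sum_nonneg fun x _ => (P.prob_pos x).le

/-- The expectation of a function of one spin needs only the law of that spin; this reduces sums
over configurations to the two values of `x_k`. -/
theorem sum_prob_mul (k : Fin n) (s : ℤˣ) (g : ℤˣ → ℝ) :
    ∑ x, P.prob x * g (x k) = P.marginal k s * g s + P.marginal k (-s) * g (-s) := by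
  have h : ∀ t, P.marginal k t * g t = ∑ x, if x k = t then P.prob x * g (x k) else 0 := by
    intro t
    rw [marginal, Finset.sum_mul, ← Finset.sum_filter]
    refine Finset.sum_congr rfl fun x hx => ?_
    rw [(Finset.mem_filter.1 hx).2]
  rw [← sum_units s fun t => P.marginal k t * g t]
  simp only [h]
  rw [Finset.sum_comm]
  exact Finset.sum_congr rfl fun x _ => by rw [Finset.sum_ite_eq, if_pos (Finset.mem_univ _)]

theorem marginal_add_marginal_neg (k : Fin n) (s : ℤˣ) :
    P.marginal k s + P.marginal k (-s) = 1 := by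
  simpa [P.sum_prob] using (P.sum_prob_mul k s fun _ => 1).symm

theorem abs_exponent_le {W H : ℝ} (hW : 0 ≤ W) (hw : ∀ j i, |P.w j i| ≤ W)
    (hh : ∀ j, |P.h j| ≤ H) (x : SpinConfig n) : |P.exponent x| ≤ n * n * W + n * H := by
  refine (abs_add_le _ _).trans (add_le_add ?_ ?_)
  · have h1 : ∀ j : Fin n, |∑ i : Fin (j : ℕ),
        P.w j i * spinVal (x ⟨i, i.isLt.trans j.isLt⟩) * spinVal (x j)| ≤ n * W := by
      intro j
      have h2 : ∀ i : Fin (j : ℕ),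
          |P.w j i * spinVal (x ⟨i, i.isLt.trans j.isLt⟩) * spinVal (x j)| ≤ W := by
        intro i
        rw [abs_mul, abs_mul, abs_spinVal, abs_spinVal, mul_one, mul_one]
        exact hw j i
      calc _ ≤ ∑ i : Fin (j : ℕ), W :=
            (Finset.abs_sum_le_sum_abs _ _).trans (Finset.sum_le_sum fun i _ => h2 i)
        _ = (j : ℕ) * W := by simp
        _ ≤ n * W := mul_le_mul_of_nonneg_right (by exact_mod_cast j.isLt.le) hW
    calc _ ≤ ∑ j : Fin n, (n : ℝ) * W :=
          (Finset.abs_sum_le_sum_abs _ _).trans (Finset.sum_le_sum fun j _ => h1 j)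
      _ = n * n * W := by simp [mul_assoc]
  · calc _ ≤ ∑ j : Fin n, H := (Finset.abs_sum_le_sum_abs _ _).trans
          (Finset.sum_le_sum fun j _ => by
            rw [abs_mul, abs_spinVal, mul_one]
            exact hh j)
      _ = n * H := by simp

/-- The global flip `x ↦ -x` exchanges the events `x_k = s` and `x_k = -s` and changes each exponent
by at most `2 M`. Hence the two marginals, which add up to `1`, differ at most by the factor `exp (2
M)`. -/
theorem le_marginal {M : ℝ} (hM : ∀ x, |P.exponent x| ≤ M) (k : Fin n) (s : ℤˣ) :
    Real.exp (-(2 * M)) / 2 ≤ P.marginal k s := by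
  have h1 : P.marginal k (-s) ≤ Real.exp (2 * M) * P.marginal k s := by
    have h2 : P.marginal k (-s) = ∑ x : SpinConfig n with x k = s, P.prob (-x) := by
      refine Finset.sum_nbij' (fun x => -x) (fun x => -x) ?_ ?_ ?_ ?_ ?_
      · intro x hx
        simpa [neg_eq_iff_eq_neg] using hx
      · intro x hx
        simpa using hx
      all_goals simp
    rw [h2, marginal, Finset.mul_sum]
    refine Finset.sum_le_sum fun x _ => ?_
    rw [prob, prob, ← mul_div_assoc, ← Real.exp_add]
    refine div_le_div_of_nonneg_right (Real.exp_le_exp.2 ?_) P.partitionFunction_pos.le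
    linarith [(abs_le.1 (hM x)).1, (abs_le.1 (hM (-x))).2]
  have h3 := P.marginal_add_marginal_neg k s
  have hM0 : 0 ≤ M := (abs_nonneg _).trans (hM 1)
  have h4 : (1 : ℝ) ≤ Real.exp (2 * M) := Real.one_le_exp (by linarith)
  have h5 : P.marginal k s ≤ Real.exp (2 * M) * P.marginal k s :=
    le_mul_of_one_le_left (P.marginal_nonneg k s) h4
  rw [Real.exp_neg, div_le_iff₀ two_pos, inv_le_iff_one_le_mul₀ (Real.exp_pos _)]
  linarith

theorem exponent_addDummy (k : Fin n) (c h₀ : ℝ) (x : SpinConfig n) (t : ℤˣ) :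
    (P.addDummy k c h₀).exponent (Fin.snoc x t) =
      P.exponent x + (c * spinVal (x k) + h₀) * spinVal t := by
  have h1 : ∀ i (hi : i < n), (Fin.snoc x t : SpinConfig (n + 1)) ⟨i, by omega⟩ = x ⟨i, hi⟩ :=
    fun i hi => Fin.snoc_castSucc (α := fun _ => ℤˣ) t x ⟨i, hi⟩
  have h2 : (Fin.snoc x t : SpinConfig (n + 1)) (Fin.last n) = t :=
    Fin.snoc_last (α := fun _ => ℤˣ) t x
  have h3 : ∑ i : Fin n, (if (i : ℕ) = (k : ℕ) then c else 0) *
      spinVal ((Fin.snoc x t : SpinConfig (n + 1)) ⟨i, i.isLt.trans (Nat.lt_succ_self n)⟩) *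
        spinVal t = c * spinVal (x k) * spinVal t := by
    rw [Finset.sum_eq_single k]
    · rw [if_pos rfl, h1 k k.isLt]
    · intro i _ hi
      rw [if_neg (fun h => hi (Fin.ext h)), zero_mul, zero_mul]
    · simp
  rw [exponent, Fin.sum_univ_castSucc, Fin.sum_univ_castSucc, exponent]
  have h4 : ∀ j : Fin n, (Fin.snoc x t : SpinConfig (n + 1)) j.castSucc = x j :=
    fun j => Fin.snoc_castSucc (α := fun _ => ℤˣ) t x j
  have h5 : (∑ j : Fin n, ∑ i : Fin (j.castSucc : ℕ), (P.addDummy k c h₀).w j.castSucc i *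
        spinVal ((Fin.snoc x t : SpinConfig (n + 1)) ⟨i, i.isLt.trans j.castSucc.isLt⟩) *
          spinVal ((Fin.snoc x t : SpinConfig (n + 1)) j.castSucc)) =
      ∑ j : Fin n, ∑ i : Fin (j : ℕ),
        P.w j i * spinVal (x ⟨i, i.isLt.trans j.isLt⟩) * spinVal (x j) := by
    refine Finset.sum_congr rfl fun j _ => Finset.sum_congr rfl fun i _ => ?_
    rw [h4, h1 i (i.isLt.trans j.isLt)]
    simp [addDummy]
  have h6 : (∑ i : Fin (Fin.last n : ℕ), (P.addDummy k c h₀).w (Fin.last n) i *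
        spinVal ((Fin.snoc x t : SpinConfig (n + 1)) ⟨i, i.isLt.trans (Fin.last n).isLt⟩) *
          spinVal ((Fin.snoc x t : SpinConfig (n + 1)) (Fin.last n))) =
      c * spinVal (x k) * spinVal t := by
    rw [← h3, h2]
    simp [addDummy]
  rw [h5, h6]
  simp only [h4, h2]
  simp [addDummy]
  ring

theorem sum_spinConfig_succ (s : ℤˣ) (f : SpinConfig (n + 1) → ℝ) :
    ∑ y, f y = ∑ x : SpinConfig n, (f (Fin.snoc x s) + f (Fin.snoc x (-s))) := by
  rw [← (Fin.snocEquiv fun _ : Fin (n + 1) => ℤˣ).sum_comp, Fintype.sum_prod_type_right]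
  exact Finset.sum_congr rfl fun x _ => sum_units s _

/-- The weight of the value `t` of the dummy spin when the value of its neighbour is `v`. -/
def dummyWeight (c h₀ : ℝ) (v t : ℤˣ) : ℝ := Real.exp ((c * spinVal v + h₀) * spinVal t)

/-- The exponent splits into that of `P` and a term in `x_k` and `t` only. The denominator is the
new partition function divided by the old one. -/
theorem prob_addDummy (k : Fin n) (s : ℤˣ) (c h₀ : ℝ) (x : SpinConfig n) (t : ℤˣ) :
    (P.addDummy k c h₀).prob (Fin.snoc x t) = P.prob x * (dummyWeight c h₀ (x k) t /
      (P.marginal k s * (dummyWeight c h₀ s s + dummyWeight c h₀ s (-s)) +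
        P.marginal k (-s) * (dummyWeight c h₀ (-s) s + dummyWeight c h₀ (-s) (-s)))) := by
  have h1 : ∀ x t, Real.exp ((P.addDummy k c h₀).exponent (Fin.snoc x t)) =
      P.partitionFunction * (P.prob x * dummyWeight c h₀ (x k) t) := by
    intro x t
    rw [exponent_addDummy, Real.exp_add, exp_exponent, dummyWeight]
    ring
  have h2 : (P.addDummy k c h₀).partitionFunction = P.partitionFunction *
      (P.marginal k s * (dummyWeight c h₀ s s + dummyWeight c h₀ s (-s)) +
        P.marginal k (-s) * (dummyWeight c h₀ (-s) s + dummyWeight c h₀ (-s) (-s))) := by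
    rw [partitionFunction, sum_spinConfig_succ s,
      ← P.sum_prob_mul k s fun v => dummyWeight c h₀ v s + dummyWeight c h₀ v (-s), Finset.mul_sum]
    refine Finset.sum_congr rfl fun x _ => ?_
    rw [h1, h1]
    ring
  rw [prob, h1, h2, mul_div_mul_left _ _ P.partitionFunction_pos.ne', mul_div_assoc]

/-- Each weight has the common factor `exp (c + η)`, where `η = -s h₀`; without it the four weights
for `c = δ` are `r, u, u r, 1`. The factor is absorbed in `A` (for `c = 0`) and `I` (for `c = δ`),
which are characterised by the total mass being `1`. -/
theorem tvDist_addDummy (k : Fin n) (s : ℤˣ) (h₀ δ : ℝ) :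
    ∃ A I : ℝ, A * (1 + Real.exp (-(2 * -(spinVal s * h₀)))) = 1 ∧
      I * (P.marginal k s * (Real.exp (-(2 * -(spinVal s * h₀))) + Real.exp (-(2 * δ))) +
        P.marginal k (-s) *
          (Real.exp (-(2 * δ)) * Real.exp (-(2 * -(spinVal s * h₀))) + 1)) = 1 ∧
      (P.addDummy k 0 h₀).tvDist (P.addDummy k δ h₀) = 1 / 2 *
        (P.marginal k s * (|A * Real.exp (-(2 * -(spinVal s * h₀))) -
            I * Real.exp (-(2 * -(spinVal s * h₀)))| + |A - I * Real.exp (-(2 * δ))|) +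
          P.marginal k (-s) * (|A * Real.exp (-(2 * -(spinVal s * h₀))) -
            I * (Real.exp (-(2 * δ)) * Real.exp (-(2 * -(spinVal s * h₀))))| + |A - I|)) := by
  set p := P.marginal k s with hp
  set q := P.marginal k (-s) with hq
  set η := -(spinVal s * h₀) with hη
  have hpq : p + q = 1 := P.marginal_add_marginal_neg k s
  have hp0 : 0 ≤ p := P.marginal_nonneg k s
  have hq0 : 0 ≤ q := P.marginal_nonneg k (-s)
  have hss := spinVal_mul_self s
  have w : ∀ c, dummyWeight c h₀ s s = Real.exp (c + η) * Real.exp (-(2 * η)) ∧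
      dummyWeight c h₀ s (-s) = Real.exp (c + η) * Real.exp (-(2 * c)) ∧
      dummyWeight c h₀ (-s) s =
        Real.exp (c + η) * (Real.exp (-(2 * c)) * Real.exp (-(2 * η))) ∧
      dummyWeight c h₀ (-s) (-s) = Real.exp (c + η) := by
    intro c
    simp only [dummyWeight, ← Real.exp_add, spinVal_neg]
    refine ⟨?_, ?_, ?_, ?_⟩ <;> congr 1 <;> rw [hη]
    · linear_combination c * hss
    · linear_combination -c * hss
    · linear_combination -c * hss
    · linear_combination c * hss
  set D : ℝ → ℝ := fun c => p * (dummyWeight c h₀ s s + dummyWeight c h₀ s (-s)) +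
    q * (dummyWeight c h₀ (-s) s + dummyWeight c h₀ (-s) (-s)) with hD
  have hD' : ∀ c, D c = Real.exp (c + η) * (p * (Real.exp (-(2 * η)) + Real.exp (-(2 * c))) +
      q * (Real.exp (-(2 * c)) * Real.exp (-(2 * η)) + 1)) := by
    intro c
    obtain ⟨w1, w2, w3, w4⟩ := w c
    rw [hD]
    simp only [w1, w2, w3, w4]
    ring
  have hD0 : ∀ c, D c ≠ 0 := by
    intro c
    have h1 : 0 < D c := by
      have h2 : 0 < p ∨ 0 < q := by
        by_contra! h
        linarith
      simp only [hD, dummyWeight]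
      rcases h2 with h2 | h2 <;> positivity
    exact h1.ne'
  refine ⟨Real.exp (0 + η) / D 0, Real.exp (δ + η) / D δ, ?_, ?_, ?_⟩
  · rw [div_mul_eq_mul_div, div_eq_one_iff_eq (hD0 0), hD' 0, mul_zero, neg_zero, Real.exp_zero]
    linear_combination -(Real.exp (0 + η) * (1 + Real.exp (-(2 * η)))) * hpq
  · rw [div_mul_eq_mul_div, div_eq_one_iff_eq (hD0 δ), hD' δ]
  · have h1 : (P.addDummy k 0 h₀).tvDist (P.addDummy k δ h₀) = 1 / 2 * ∑ x, P.prob x *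
        (|dummyWeight 0 h₀ (x k) s / D 0 - dummyWeight δ h₀ (x k) s / D δ| +
          |dummyWeight 0 h₀ (x k) (-s) / D 0 - dummyWeight δ h₀ (x k) (-s) / D δ|) := by
      rw [tvDist, sum_spinConfig_succ s]
      congr 1
      refine Finset.sum_congr rfl fun x _ => ?_
      rw [P.prob_addDummy k s, P.prob_addDummy k s, P.prob_addDummy k s, P.prob_addDummy k s,
        ← mul_sub, ← mul_sub, abs_mul, abs_mul, abs_of_pos (P.prob_pos x), ← mul_add]
    obtain ⟨w1, w2, w3, w4⟩ := w 0
    obtain ⟨v1, v2, v3, v4⟩ := w δ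
    rw [h1, P.sum_prob_mul k s fun v => |dummyWeight 0 h₀ v s / D 0 - dummyWeight δ h₀ v s / D δ| +
      |dummyWeight 0 h₀ v (-s) / D 0 - dummyWeight δ h₀ v (-s) / D δ|]
    simp only [w1, w2, w3, w4, v1, v2, v3, v4, mul_zero, neg_zero, Real.exp_zero, mul_one, one_mul,
      div_mul_eq_mul_div]
    rfl

/-- The total variation distance approximates the marginal once the field and the coupling of the
dummy spin are large. -/
theorem isMulApprox_tvDist_addDummy (k : Fin n) (s : ℤˣ) {W H ε h₀ δ : ℝ} (hW : 0 ≤ W)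
    (hw : ∀ j i, |P.w j i| ≤ W) (hh : ∀ j, |P.h j| ≤ H) (hε : 0 < ε)
    (h1 : ((4 : ℕ) : ℝ) * (n + W + H + 1 / ε + 1) ^ 3 ≤ -(spinVal s * h₀))
    (h2 : ((4 : ℕ) : ℝ) * (n + W + H + 1 / ε + 1) ^ 3 ≤ δ) :
    IsMulApprox ε (P.marginal k s) ((P.addDummy k 0 h₀).tvDist (P.addDummy k δ h₀)) := by
  obtain ⟨A, I, hA, hI, hT⟩ := P.tvDist_addDummy k s h₀ δ
  have hp := P.le_marginal (P.abs_exponent_le hW hw hh) k s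
  have hq := P.le_marginal (P.abs_exponent_le hW hw hh) k (-s)
  have hpq := P.marginal_add_marginal_neg k s
  rw [hT]
  set p := P.marginal k s
  set q := P.marginal k (-s)
  set η := -(spinVal s * h₀)
  set M := n * n * W + n * H with hM
  set B := ((4 : ℕ) : ℝ) * (n + W + H + 1 / ε + 1) ^ 3 with hB
  have hH : 0 ≤ H := (abs_nonneg _).trans (hh k)
  have he : 0 < 1 / ε := by positivity
  have hn : (0 : ℝ) ≤ n := n.cast_nonneg
  -- Let `y` be the base of the cube. Then `M ≤ y³ + y² ≤ 2 y³` and `B = 4 y³`, so `2 B - 2 M ≥ 4 y³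
  -- ≥ 4 (1 + 1 / ε)`. The spare `1` is that of `x + 1 ≤ exp x`, used next.
  have hBM : 4 * (1 + 1 / ε) ≤ 2 * B - 2 * M + 1 := by
    set e := 1 / ε
    set y := (n + W + H + e + 1 : ℝ) with hy
    have y1 : 1 ≤ y := by linarith
    have y2 : (n : ℝ) * n * W ≤ y * y * y := by
      gcongr <;> linarith
    have y3 : (n : ℝ) * H ≤ y * y := by
      gcongr <;> linarith
    have y4 : y * y ≤ y * y * y := le_mul_of_one_le_right (by positivity) y1
    have y5 : y ≤ y * y := le_mul_of_one_le_right (by positivity) y1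
    have y6 : B = 4 * (y * y * y) := by
      rw [hB]
      push_cast
      ring
    rw [y6, hM]
    linarith
  have hexp : Real.exp (-(2 * B)) * (4 * (1 + 1 / ε)) ≤ Real.exp (-(2 * M)) := by
    have h3 : 4 * (1 + 1 / ε) ≤ Real.exp (2 * B - 2 * M) :=
      hBM.trans (Real.add_one_le_exp _)
    calc _ ≤ Real.exp (-(2 * B)) * Real.exp (2 * B - 2 * M) := by gcongr
      _ = Real.exp (-(2 * M)) := by
        rw [← Real.exp_add]
        congr 1
        ring
  have hr : Real.exp (-(2 * η)) ≤ Real.exp (-(2 * B)) := Real.exp_le_exp.2 (by linarith)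
  have hu : Real.exp (-(2 * δ)) ≤ Real.exp (-(2 * B)) := Real.exp_le_exp.2 (by linarith)
  have hB0 : 0 ≤ B := by positivity
  have hu1 : Real.exp (-(2 * δ)) ≤ 1 := Real.exp_le_one_iff.2 (by linarith)
  have hr0 := Real.exp_pos (-(2 * η))
  have hu0 := Real.exp_pos (-(2 * δ))
  set r := Real.exp (-(2 * η))
  set u := Real.exp (-(2 * δ))
  set b := Real.exp (-(2 * B))
  set m := Real.exp (-(2 * M))
  have hm : 0 < m := Real.exp_pos _
  have hb : 0 < b := Real.exp_pos _
  have hp0 : 0 < p := by linarith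
  have hq0 : 0 < q := by linarith
  -- As `p, q ≥ m / 2` and `r, u ≤ b`, this gives both `(r + u) / q ≤ ε / (1 + ε)` and `r ≤ p ε`.
  have hbm : b * (4 * (1 + ε)) ≤ m * ε := by
    have : b * (4 * (1 + ε)) = b * (4 * (1 + 1 / ε)) * ε := by
      field_simp
      ring
    rw [this]
    exact mul_le_mul_of_nonneg_right hexp hε.le
  constructor
  · refine le_trans ?_ (le_tv_of_mul_eq_one hp0 hq0 hpq hr0.le hu0.le hA hI)
    have h3 : (r + u) / q ≤ ε / (1 + ε) := by
      rw [div_le_div_iff₀ hq0 (by linarith)]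
      nlinarith
    have h4 : p / (1 + ε) = p - p * (ε / (1 + ε)) := by
      field_simp
      ring
    rw [h4]
    linarith [mul_le_mul_of_nonneg_left h3 hp0.le]
  · refine (tv_le_of_mul_eq_one hp0 hq0 hpq hr0.le hu0.le hu1 hA hI).trans ?_
    have h3 : m / 2 * ε ≤ p * ε := mul_le_mul_of_nonneg_right hp hε.le
    have h4 : 0 < b * ε := mul_pos hb hε
    linarith

end IsingModel

theorem IsMulApprox.trans {ε ε' a v v' : ℝ} (h : IsMulApprox ε a v) (h' : IsMulApprox ε v v')
    (ha : 0 ≤ a) (hε : 0 < ε) (hε' : (1 + ε) * (1 + ε) ≤ 1 + ε') : IsMulApprox ε' a v' := by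
  obtain ⟨h1, h2⟩ := h
  obtain ⟨h3, h4⟩ := h'
  constructor
  · calc a / (1 + ε') ≤ a / ((1 + ε) * (1 + ε)) := by gcongr
      _ = a / (1 + ε) / (1 + ε) := (div_div _ _ _).symm
      _ ≤ v / (1 + ε) := by gcongr
      _ ≤ v' := h3
  · calc v' ≤ (1 + ε) * v := h4
      _ ≤ (1 + ε) * ((1 + ε) * a) := by gcongr
      _ = (1 + ε) * (1 + ε) * a := by ring
      _ ≤ (1 + ε') * a := by gcongr

/-! ### Stack programs -/

/-- A deterministic program on finitely many stacks of symbols from `A`: in the state `q` it pops the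
stack `src q`, pushes the word `act q o j` (where `o` is the popped symbol) on every stack `j`, and
goes to the state `next q o`, where `none` means that it has finished.  The stack `none` is only
written on. -/
structure StackProgram (A : Type) where
  {J : Type}
  {Q : Type}
  [decJ : DecidableEq J]
  [finJ : Fintype J]
  [finQ : Fintype Q]
  input : J
  start : Q
  src : Q → J
  next : Q → Option A → Option Q
  act : Q → Option A → Option J → List A

namespace StackProgram

variable {A : Type} (P : StackProgram A)

instance : DecidableEq P.J := P.decJ
instance : Fintype P.J := P.finJ
instance : Fintype P.Q := P.finQ

/-- The contents of the stacks of a program. -/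
abbrev Stacks : Type := Option P.J → List A

/-- The stacks after one step in the state `q`. -/
def stepStacks (q : P.Q) (S : P.Stacks) : P.Stacks := fun j =>
  P.act q (S (P.src q)).head? j ++ if j = some (P.src q) then (S (P.src q)).tail else S j

/-- `P.Steps t q S q' S'`: in `t` steps the program gets from the state `q` and the stacks `S` to the
state `q'` and the stacks `S'`. -/
inductive Steps : ℕ → Option P.Q → P.Stacks → Option P.Q → P.Stacks → Prop
  | refl (q : Option P.Q) (S : P.Stacks) : Steps 0 q S q S
  | head {t : ℕ} {q : P.Q} {S : P.Stacks} {q' : Option P.Q} {S' : P.Stacks}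
      (h : Steps t (P.next q (S (P.src q)).head?) (P.stepStacks q S) q' S') :
      Steps (t + 1) (some q) S q' S'

variable {P}

theorem Steps.trans {t t' : ℕ} {q q' q'' : Option P.Q} {S S' S'' : P.Stacks}
    (h : P.Steps t q S q' S') (h' : P.Steps t' q' S' q'' S'') :
    P.Steps (t + t') q S q'' S'' := by
  induction h with
  | refl => simpa using h'
  | head _ ih =>
    rw [Nat.add_right_comm]
    exact .head (ih h')

theorem Steps.single {q : P.Q} {S : P.Stacks} {q' : Option P.Q} {S' : P.Stacks}
    (hq : P.next q (S (P.src q)).head? = q') (hS : P.stepStacks q S = S') :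
    P.Steps 1 (some q) S q' S' := by
  subst hq hS
  exact .head (.refl _ _)

/-- The stacks after a loop in the state `q` has popped the word `l` and left the word `r`. -/
def loopStacks (q : P.Q) (l r : List A) (S : P.Stacks) : P.Stacks := fun j =>
  if j = some (P.src q) then r else (l.reverse.flatMap fun x => P.act q (some x) j) ++ S j

/-- The hypothesis `ha` says that the loop never pushes on the stack it pops; otherwise the word
being read would change. -/
theorem Steps.loop {q : P.Q} {l r : List A} {S : P.Stacks} (hS : S (some (P.src q)) = l ++ r)
    (hn : ∀ x ∈ l, P.next q (some x) = some q)
    (ha : ∀ x ∈ l, P.act q (some x) (some (P.src q)) = []) :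
    P.Steps l.length (some q) S (some q) (loopStacks q l r S) := by
  induction l generalizing S with
  | nil =>
    have h : loopStacks q [] r S = S := by
      funext j
      by_cases hj : j = some (P.src q) <;> simp [loopStacks, hj, hS]
    rw [h]
    exact .refl _ _
  | cons x l ih =>
    refine .head ?_
    have hh : (S (some (P.src q))).head? = some x := by simp [hS]
    rw [hh, hn x List.mem_cons_self]
    have h1 : P.stepStacks q S (some (P.src q)) = l ++ r := by
      simp [stepStacks, hS, ha x List.mem_cons_self]
    convert ih h1 (fun y hy => hn y (List.mem_cons_of_mem _ hy))
      (fun y hy => ha y (List.mem_cons_of_mem _ hy)) using 1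
    funext j
    by_cases hj : j = some (P.src q) <;>
      simp [loopStacks, hj, stepStacks, hh]

/-- The stacks after a loop in the state `q` has popped all of the word `l`, and then has left the
state `q` because the stack was empty. -/
def drainStacks (q : P.Q) (l : List A) (S : P.Stacks) : P.Stacks := fun j =>
  P.act q none j ++ loopStacks q l [] S j

/-- The extra step is the one that pops the empty stack; it performs the action for `none` and
leaves the loop. -/
theorem Steps.drain {q : P.Q} {l : List A} {S : P.Stacks} {q' : Option P.Q} {S' : P.Stacks}
    (hS : S (some (P.src q)) = l) (hn : ∀ x ∈ l, P.next q (some x) = some q)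
    (ha : ∀ x ∈ l, P.act q (some x) (some (P.src q)) = [])
    (hq : P.next q none = q') (hS' : drainStacks q l S = S') :
    P.Steps (l.length + 1) (some q) S q' S' := by
  refine (Steps.loop (r := []) (by simpa using hS) hn ha).trans (.single ?_ ?_)
  · simpa [loopStacks] using hq
  · rw [← hS']
    funext j
    by_cases hj : j = some (P.src q) <;> simp [stepStacks, drainStacks, loopStacks, hj]

end StackProgram

/-! ### Running a stack program before a machine -/

namespace ProbTM

open Turing TM2

variable {A : Type} (P : StackProgram A) (M : ProbTM)

/-- The stack alphabets of the composed machine. -/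
abbrev preΓ : M.K ⊕ P.J → Type
  | Sum.inl k => M.Γ k
  | Sum.inr _ => A

/-- The labels of the composed machine; `(q, o)` is the label where the program, having popped `o`
in the state `q`, pushes the words it has to push. -/
abbrev preΛ : Type := M.Λ ⊕ (P.Q ⊕ P.Q × Option A)

/-- A statement of `M`, as one of the composed machine. -/
def liftStmt : Stmt M.Γ M.Λ M.σ → Stmt (M.preΓ P) (M.preΛ P) (M.σ × Option A)
  | .push k f q => .push (Sum.inl k) (fun v => f v.1) (liftStmt q)
  | .peek k f q => .peek (Sum.inl k) (fun v o => (f v.1 o, v.2)) (liftStmt q)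
  | .pop k f q => .pop (Sum.inl k) (fun v o => (f v.1 o, v.2)) (liftStmt q)
  | .load f q => .load (fun v => (f v.1, v.2)) (liftStmt q)
  | .branch f q q' => .branch (fun v => f v.1) (liftStmt q) (liftStmt q')
  | .goto f => .goto fun v => Sum.inl (f v.1)
  | .halt => .halt

variable (inp : M.Γ M.k₀ ≃ A)

/-- Pushing a symbol. -/
def pushSymbol (x : A) (s : Stmt (M.preΓ P) (M.preΛ P) (M.σ × Option A)) :
    Option P.J → Stmt (M.preΓ P) (M.preΛ P) (M.σ × Option A)
  | none => .push (Sum.inl M.k₀) (fun _ => inp.symm x) s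
  | some j => .push (Sum.inr j) (fun _ => x) s

/-- Pushing a word. -/
def pushWord (j : Option P.J) : List A → Stmt (M.preΓ P) (M.preΛ P) (M.σ × Option A) →
    Stmt (M.preΓ P) (M.preΛ P) (M.σ × Option A)
  | [], s => s
  | x :: l, s => pushWord j l (pushSymbol P M inp x s j)

/-- Pushing words on several stacks. -/
def pushWords (w : Option P.J → List A) (s : Stmt (M.preΓ P) (M.preΛ P) (M.σ × Option A)) :
    List (Option P.J) → Stmt (M.preΓ P) (M.preΛ P) (M.σ × Option A)
  | [] => s
  | j :: l => pushWord P M inp j (w j) (pushWords w s l)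

/-- The statements of the stack program. -/
def preStmt : P.Q ⊕ P.Q × Option A → Stmt (M.preΓ P) (M.preΛ P) (M.σ × Option A)
  | Sum.inl q => .pop (Sum.inr (P.src q)) (fun v o => (v.1, o))
      (.goto fun v => Sum.inr (Sum.inr (q, v.2)))
  | Sum.inr (q, o) => pushWords P M inp (P.act q o)
      (.goto fun _ => (P.next q o).elim (Sum.inl M.main) fun q' => Sum.inr (Sum.inl q'))
      Finset.univ.toList

/-- The stacks of the composed machine. -/
def joinStk (S : ∀ k, List (M.Γ k)) (X : P.J → List A) : ∀ k, List (M.preΓ P k)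
  | Sum.inl k => S k
  | Sum.inr j => X j

variable {P M} in
theorem update_joinStk_inl (S : ∀ k, List (M.Γ k)) (X : P.J → List A) (k : M.K)
    (l : List (M.Γ k)) :
    Function.update (joinStk P M S X) (Sum.inl k) l = joinStk P M (Function.update S k l) X := by
  funext k'
  rcases k' with k' | j
  · by_cases h : k' = k
    · subst h
      simp [joinStk]
    · rw [Function.update_of_ne (by simpa using h)]
      simp [joinStk, h]
  · rw [Function.update_of_ne (by simp)]
    rfl

variable {P M} in
theorem update_joinStk_inr (S : ∀ k, List (M.Γ k)) (X : P.J → List A) (j : P.J) (l : List A) :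
    Function.update (joinStk P M S X) (Sum.inr j) l = joinStk P M S (Function.update X j l) := by
  funext k'
  rcases k' with k | j'
  · rw [Function.update_of_ne (by simp)]
    rfl
  · by_cases h : j' = j
    · subst h
      simp [joinStk]
    · rw [Function.update_of_ne (by simpa using h)]
      simp [joinStk, h]

variable {P M inp}

variable (inp) in
/-- The stacks of the composed machine while the program runs. -/
def preStk (S : P.Stacks) : ∀ k, List (M.preΓ P k) :=
  joinStk P M (Function.update (fun _ => []) M.k₀ ((S none).map inp.symm)) fun j => S (some j)

theorem update_preStk_inr (S : P.Stacks) (j : P.J) (l : List A) :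
    Function.update (preStk inp S) (Sum.inr j) l =
      preStk inp (Function.update S (some j) l) := by
  rw [preStk, update_joinStk_inr, preStk, Function.update_of_ne (by simp)]
  congr 1
  funext j'
  by_cases h : j' = j
  · subst h
    simp
  · simp [h]

theorem update_preStk_inl (S : P.Stacks) (l : List A) :
    Function.update (preStk inp S) (Sum.inl M.k₀) (l.map inp.symm) =
      preStk inp (Function.update S none l) := by
  rw [preStk, update_joinStk_inl, preStk]
  simp

/-- The head of the word is pushed last, so the word ends up on the stack in reading order from the
top. -/
theorem stepAux_pushWord (j : Option P.J) (l : List A) (v : M.σ × Option A) (S : P.Stacks)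
    (s : Stmt (M.preΓ P) (M.preΛ P) (M.σ × Option A)) :
    stepAux (pushWord P M inp j l s) v (preStk inp S) =
      stepAux s v (preStk inp (Function.update S j (l ++ S j))) := by
  induction l generalizing s with
  | nil => simp [pushWord]
  | cons x l ih =>
    rw [pushWord, ih]
    cases j with
    | none =>
      simp only [stepAux, pushSymbol]
      have h : inp.symm x :: preStk inp (Function.update S none (l ++ S none)) (Sum.inl M.k₀) =
          (x :: (l ++ S none)).map inp.symm := by
        simp [preStk, joinStk]
      rw [h, update_preStk_inl]
      simp
    | some j =>
      simp only [stepAux, pushSymbol]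
      have h : x :: preStk inp (Function.update S (some j) (l ++ S (some j))) (Sum.inr j) =
          x :: (l ++ S (some j)) := by
        simp [preStk, joinStk]
      rw [h, update_preStk_inr]
      simp

theorem stepAux_pushWords (w : Option P.J → List A) (js : List (Option P.J)) (hj : js.Nodup)
    (v : M.σ × Option A) (S : P.Stacks) (s : Stmt (M.preΓ P) (M.preΛ P) (M.σ × Option A)) :
    stepAux (pushWords P M inp w s js) v (preStk inp S) =
      stepAux s v (preStk inp fun j => if j ∈ js then w j ++ S j else S j) := by
  induction js generalizing S with
  | nil => simp [pushWords]
  | cons j js ih =>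
    rw [pushWords, stepAux_pushWord, ih hj.of_cons]
    congr 2
    funext j'
    by_cases h : j' = j
    · subst h
      simp [(List.nodup_cons.1 hj).1]
    · simp [h]

variable [Fintype A]

variable (P M inp)

/-- The machine which runs the program `P` and then the machine `M`, on the word that `P` has left on
the stack `none`. -/
def precomp : ProbTM where
  K := M.K ⊕ P.J
  kDecidableEq := @instDecidableEqSum _ _ M.kDecidableEq P.decJ
  kFin := @instFintypeSum _ _ M.kFin P.finJ
  k₀ := Sum.inr P.input
  k₁ := Sum.inl M.k₁
  Γ := M.preΓ P
  Λ := M.preΛ P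
  main := Sum.inr (Sum.inl P.start)
  ΛFin :=
    letI := M.ΛFin
    inferInstance
  σ := M.σ × Option A
  initialState := (M.initialState, none)
  σFin :=
    letI := M.σFin
    inferInstance
  Γk₀Fin := inferInstanceAs (Fintype A)
  -- Both programs agree on the labels of `P`, so the coin has no influence until `M` starts.
  m := Sum.elim (fun l => liftStmt P M (M.m l)) (preStmt P M inp)
  m' := Sum.elim (fun l => liftStmt P M (M.m' l)) (preStmt P M inp)

/-- The input alphabet of the composed machine. -/
def precompInp : (precomp P M inp).Γ (precomp P M inp).k₀ ≃ A := Equiv.refl A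

/-- A configuration of `M`, as one of the composed machine. -/
def liftCfg (o : Option A) (X : P.J → List A) (c : M.Cfg) : (precomp P M inp).Cfg :=
  ⟨c.l.map Sum.inl, (c.var, o), joinStk P M c.stk X⟩

variable {P M inp}

/-- A lifted statement touches only the stacks and the part of the state that belong to `M`;
whatever `P` left behind is carried along unread. -/
theorem stepAux_liftStmt (s : Stmt M.Γ M.Λ M.σ) (v : M.σ) (S : ∀ k, List (M.Γ k)) (o : Option A)
    (X : P.J → List A) :
    stepAux (liftStmt P M s) (v, o) (joinStk P M S X) =
      liftCfg P M inp o X (stepAux s v S) := by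
  induction s generalizing v S with
  | push k f q ih =>
    simp only [liftStmt, stepAux]
    rw [update_joinStk_inl, ← ih]
    rfl
  | peek k f q ih =>
    simp only [liftStmt, stepAux]
    rw [← ih]
    rfl
  | pop k f q ih =>
    simp only [liftStmt, stepAux]
    rw [update_joinStk_inl, ← ih]
    rfl
  | load f q ih =>
    simp only [liftStmt, stepAux]
    rw [← ih]
  | branch f q q' ih ih' =>
    simp only [liftStmt, stepAux]
    cases f v
    · exact ih' _ _
    · exact ih _ _
  | goto f => rfl
  | halt => rfl

theorem coinStep_liftCfg (b : Bool) (o : Option A) (X : P.J → List A) (c : M.Cfg) :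
    (precomp P M inp).coinStep b (liftCfg P M inp o X c) =
      liftCfg P M inp o X (M.coinStep b c) := by
  obtain ⟨l, v, S⟩ := c
  cases l with
  | none => rfl
  | some l =>
    cases b
    · exact stepAux_liftStmt (inp := inp) (M.m' l) v S o X
    · exact stepAux_liftStmt (inp := inp) (M.m l) v S o X

theorem run_liftCfg (t : ℕ) (o : Option A) (X : P.J → List A) (c : M.Cfg) :
    (precomp P M inp).run t (liftCfg P M inp o X c) =
      (M.run t c).map (liftCfg P M inp o X) := by
  induction t generalizing c with
  | zero => exact (PMF.pure_map _ _).symm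
  | succ t ih =>
    simp only [run, step, PMF.bind_map, PMF.map_bind]
    congr 1
    funext b
    simp only [Function.comp_apply]
    rw [coinStep_liftCfg, ih]

theorem run_succ_of_coinStep {N : ProbTM} {c c' : N.Cfg} (h : ∀ b, N.coinStep b c = c') (t : ℕ) :
    N.run (t + 1) c = N.run t c' := by
  have h1 : (fun b => N.coinStep b c) = Function.const _ c' := funext h
  simp only [run, step]
  rw [h1, PMF.map_const, PMF.pure_bind]

/-- The configuration of the composed machine in the state `q` of the program. -/
def preCfg (q : Option P.Q) (o : Option A) (S : P.Stacks) : (precomp P M inp).Cfg :=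
  ⟨some (q.elim (Sum.inl M.main) fun q' => Sum.inr (Sum.inl q')), (M.initialState, o),
    preStk inp S⟩

/-- One program step costs two machine steps: the pop, which stores the symbol in the label, and the
pushes that depend on it. Neither depends on the coin. -/
theorem run_preCfg_some (q : P.Q) (o : Option A) (S : P.Stacks) (t : ℕ) :
    (precomp P M inp).run (t + 2) (preCfg (some q) o S) =
      (precomp P M inp).run t (preCfg (P.next q (S (P.src q)).head?) (S (P.src q)).head?
        (P.stepStacks q S)) := by
  set o' := (S (P.src q)).head? with ho'
  have h1 : ∀ b, (precomp P M inp).coinStep b (preCfg (some q) o S) =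
      ⟨some (Sum.inr (Sum.inr (q, o'))), (M.initialState, o'),
        preStk inp (Function.update S (some (P.src q)) (S (P.src q)).tail)⟩ := by
    intro b
    rw [← update_preStk_inr]
    cases b <;> rfl
  rw [run_succ_of_coinStep h1]
  refine run_succ_of_coinStep (fun b => ?_) t
  have h2 := stepAux_pushWords (inp := inp) (P.act q o') Finset.univ.toList
    (Finset.nodup_toList _) (M.initialState, o')
    (Function.update S (some (P.src q)) (S (P.src q)).tail)
    (.goto fun _ => (P.next q o').elim (Sum.inl M.main) fun q' => Sum.inr (Sum.inl q'))
  simp only [Finset.mem_toList, Finset.mem_univ, if_true, Function.update_apply] at h2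
  cases b <;> exact h2

theorem run_of_steps {t : ℕ} {q q' : Option P.Q} {S S' : P.Stacks} (h : P.Steps t q S q' S')
    (o : Option A) : ∃ o', ∀ T, (precomp P M inp).run (2 * t + T) (preCfg q o S) =
      (precomp P M inp).run T (preCfg q' o' S') := by
  induction h generalizing o with
  | refl q S => exact ⟨o, fun T => by rw [Nat.mul_zero, Nat.zero_add]⟩
  | @head t q S q' S' _ ih =>
    obtain ⟨o', ho⟩ := ih (S (P.src q)).head?
    refine ⟨o', fun T => ?_⟩
    rw [show 2 * (t + 1) + T = 2 * t + T + 2 by ring, run_preCfg_some, ho]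

theorem initList_stk (N : FinTM2) (l : List (N.Γ N.k₀)) :
    (initList N l).stk = Function.update (fun _ => []) N.k₀ l := by
  funext k
  by_cases h : k = N.k₀
  · subst h
    simp [initList]
  · simp [initList, h]

/-- When `P` has finished, its output lies on the input stack of `M`, and the configuration is the
lift of an initial configuration of `M`. The leftovers `o` and `X` do not depend on `T`. -/
theorem run_precomp {t : ℕ} {x y : List A} {S' : P.Stacks}
    (h : P.Steps t (some P.start) (Function.update (fun _ => []) (some P.input) x) none S')
    (hy : S' none = y) :
    ∃ (o : Option A) (X : P.J → List A), ∀ T,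
      (precomp P M inp).run (2 * t + T) (initList (precomp P M inp).toFinTM2 x) =
        (M.run T (initList M.toFinTM2 (y.map inp.symm))).map (liftCfg P M inp o X) := by
  obtain ⟨o, ho⟩ := run_of_steps (inp := inp) h none
  refine ⟨o, fun j => S' (some j), fun T => ?_⟩
  have h1 : initList (precomp P M inp).toFinTM2 x =
      preCfg (some P.start) none (Function.update (fun _ => []) (some P.input) x) := by
    have h2 := initList_stk (precomp P M inp).toFinTM2 x
    have h3 : preStk inp (Function.update (fun _ => []) (some P.input) x) =
        Function.update (β := fun k => List (preΓ P M k)) (fun _ => []) (Sum.inr P.input) x := by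
      rw [← update_preStk_inr]
      congr 1
      funext k
      rcases k with k | j
      · simp [preStk, joinStk]
      · rfl
    rw [preCfg, h3]
    exact congrArg (Cfg.mk _ _) h2
  have h4 : preCfg none o S' = liftCfg P M inp o (fun j => S' (some j))
      (initList M.toFinTM2 (y.map inp.symm)) := by
    rw [liftCfg, initList_stk, ← hy]
    rfl
  rw [h1, ho, h4, run_liftCfg]

end ProbTM

/-! ### The program which computes the reduction -/

namespace Reduction

open StackProgram

/-- The input alphabet of approximation schemes. -/
abbrev InSymb : Type := Symb ⊕ Bool

/-- The stacks of the program. -/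
inductive Stack
  | input | scheme | index | index' | size | size' | model | model' | exp₁ | exp₂ | exp₃
  deriving DecidableEq

instance : Fintype Stack where
  elems := {.input, .scheme, .index, .index', .size, .size', .model, .model', .exp₁, .exp₂, .exp₃}
  complete j := by cases j <;> decide

/-- The states of the program.  First it reads the input, then it splits the number of spins, and then
it writes the output from right to left.  The parameter is the sign of the marginal. -/
inductive State
  | readScheme
  | readIndex (s : Bool)
  | readModel (s : Bool)
  | splitIndex (s : Bool)
  | splitSize (s : Bool)
  | skip (s : Bool)
  | writeField (s : Bool)
  | writeZeros (s : Bool)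
  | writeCoupling (s : Bool)
  | writeZeros' (s : Bool)
  | writeModel (s : Bool)
  | writeField' (s : Bool)
  | writeZeros'' (s : Bool)
  | writeModel' (s : Bool)
  | writeScheme (s : Bool)
  deriving DecidableEq, Fintype

/-- The symbol of the stacks which are used as counters. -/
abbrev tick : InSymb := Sum.inr true

/-- A counter. -/
abbrev counter (m : ℕ) : List InSymb := List.replicate m tick

/-- What every input symbol contributes to the exponent of the new parameters. -/
def tenTicks : List InSymb := counter 10

/-- What is pushed for every input symbol. -/
def ticks : Option Stack → List InSymb
  | some .exp₁ | some .exp₂ | some .exp₃ => tenTicks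
  | _ => []

/-- The accuracy `1 / a` becomes `1 / (3 a)`. -/
def schemeWord : InSymb → List InSymb
  | .inr true => List.replicate 3 (.inr true)
  | .inr false => [.inr false]
  | .inl _ => []

/-- A word pushed on one stack only. -/
def only (i : Option Stack) (l : List InSymb) (j : Option Stack) : List InSymb :=
  if j = i then l else []

/-- The end of the entry `0` or `± 2 ^ m` of a row. -/
def entryEnd : List Symb := [.slash, .bit true, .comma]

/-- The end of the entry `± 2 ^ m` of a row, with the leading digit. -/
def powEnd : List Symb := .bit true :: entryEnd

/-- The sign of the field of the new spin. -/
def signWord (s : Bool) : List Symb := if s then [.minus] else []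

/-- The stack that is popped in a state. -/
def src : State → Stack
  | .readScheme | .readIndex _ | .readModel _ => .input
  | .splitIndex _ => .index
  | .splitSize _ | .skip _ | .writeZeros _ => .size
  | .writeField _ => .exp₁
  | .writeCoupling _ => .exp₂
  | .writeZeros' _ => .index'
  | .writeModel _ => .model'
  | .writeField' _ => .exp₃
  | .writeZeros'' _ => .size'
  | .writeModel' _ => .model
  | .writeScheme _ => .scheme

/-- The next state when the popped stack is empty. -/
def nextEmpty : State → Option State
  | .readScheme => none
  | .readIndex _ => none
  | .readModel s => some (.splitIndex s)
  | .splitIndex s => some (.skip s)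
  | .splitSize _ => none
  | .skip _ => none
  | .writeField s => some (.writeZeros s)
  | .writeZeros s => some (.writeCoupling s)
  | .writeCoupling s => some (.writeZeros' s)
  | .writeZeros' s => some (.writeModel s)
  | .writeModel s => some (.writeField' s)
  | .writeField' s => some (.writeZeros'' s)
  | .writeZeros'' s => some (.writeModel' s)
  | .writeModel' s => some (.writeScheme s)
  | .writeScheme _ => none

/-- The next state when a symbol has been popped. -/
def nextSymb : State → InSymb → State
  | .readScheme, .inl (.bit s) => .readIndex s
  | .readIndex s, .inl .bar => .readModel s
  | .splitIndex s, _ => .splitSize s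
  | .splitSize s, _ => .splitIndex s
  | .skip s, _ => .writeField s
  | q, _ => q

/-- What is pushed when the popped stack is empty. -/
def pushEmpty : State → Option Stack → List InSymb
  | .writeField s => only none ((signWord s).map .inl)
  | .writeZeros _ => only none (powEnd.map .inl)
  | .writeModel _ => only none ((powEnd ++ [Symb.semicolon, Symb.bar]).map .inl)
  | .writeField' s => only none ((signWord s).map .inl)
  | _ => only none []

/-- What is pushed when a symbol has been popped. -/
def pushSymb : State → InSymb → Option Stack → List InSymb
  | .readScheme, x => fun j => ticks j ++ only (some .scheme) (schemeWord x) j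
  | .readIndex _, x => fun j => ticks j ++ only (some .index) (if x = .inl .bar then [] else [tick]) j
  | .readModel _, x => fun j => ticks j ++ only (some .model) [x] j ++ only (some .model') [x] j ++
      only (some .size) (if x = .inl .semicolon then [tick] else []) j ++
      only (some .size') (if x = .inl .semicolon then [tick] else []) j
  | .splitIndex _, _ => only (some .index') [tick]
  | .splitSize _, _ => fun _ => []
  | .skip _, _ => only none ((powEnd ++ [Symb.semicolon]).map .inl)
  | .writeField _, _ | .writeField' _, _ | .writeCoupling _, _ => only none [.inl (.bit false)]
  | .writeZeros _, _ | .writeZeros' _, _ | .writeZeros'' _, _ => only none (entryEnd.map .inl)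
  | .writeModel _, x | .writeModel' _, x | .writeScheme _, x => only none [x]

/-- The program. -/
@[reducible] def prog : StackProgram InSymb where
  J := Stack
  Q := State
  input := .input
  start := .readScheme
  src := src
  next q o := o.elim (nextEmpty q) fun x => some (nextSymb q x)
  act q o := o.elim (pushEmpty q) (pushSymb q)

/-- The stacks with the given contents. -/
def contents (i a k k' n n' w w' l₁ l₂ l₃ out : List InSymb) : Option Stack → List InSymb
  | none => out
  | some .input => i
  | some .scheme => a
  | some .index => k
  | some .index' => k'
  | some .size => n
  | some .size' => n'
  | some .model => w
  | some .model' => w'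
  | some .exp₁ => l₁
  | some .exp₂ => l₂
  | some .exp₃ => l₃

/-! ### Words pushed by the loops, and the reading and splitting phases. -/

theorem flatMap_of_eq_replicate {α β : Type} {l : List α} {f : α → List β} {c : ℕ} {y : β}
    (h : ∀ x ∈ l, f x = List.replicate c y) : l.flatMap f = List.replicate (c * l.length) y := by
  induction l with
  | nil => simp
  | cons a l ih =>
    rw [List.flatMap_cons, ih fun x hx => h x (List.mem_cons_of_mem _ hx), h a List.mem_cons_self,
      List.replicate_append_replicate, List.length_cons]
    congr 1
    ring

theorem flatMap_tenTicks {α : Type} (l : List α) :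
    (l.flatMap fun _ => tenTicks) = counter (10 * l.length) :=
  flatMap_of_eq_replicate fun _ _ => rfl

theorem tenTicks_append (m : ℕ) : tenTicks ++ counter m = counter (m + 10) := by
  rw [tenTicks, List.replicate_append_replicate, Nat.add_comm]

theorem flatMap_const_nil {α β : Type} (l : List α) : (l.flatMap fun _ => ([] : List β)) = [] := by
  simp

theorem schemeWord_inl (x : Symb) : schemeWord (.inl x) = [] := rfl

theorem counter_append (m m' : ℕ) : counter m ++ counter m' = counter (m + m') :=
  List.replicate_append_replicate

theorem flatMap_semicolon (w : List Symb) :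
    ((w.map Sum.inl).reverse.flatMap fun x : InSymb =>
      if x = Sum.inl .semicolon then [tick] else []) = counter (w.count .semicolon) := by
  rw [← List.map_reverse, ← List.count_reverse]
  induction w.reverse with
  | nil => simp
  | cons x l ih =>
    rw [List.map_cons, List.flatMap_cons, ih, List.count_cons]
    by_cases h : x = .semicolon
    · simp [h, List.replicate_succ]
    · simp [h]

theorem flatMap_schemeWord (a b : ℕ) :
    (List.replicate a (Sum.inr true) ++ List.replicate b (Sum.inr false)).reverse.flatMap schemeWord =
      List.replicate b (Sum.inr false) ++ List.replicate (3 * a) (Sum.inr true) := by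
  rw [List.reverse_append, List.reverse_replicate, List.reverse_replicate, List.flatMap_append,
    flatMap_of_eq_replicate (c := 1) (y := Sum.inr false),
    flatMap_of_eq_replicate (c := 3) (y := Sum.inr true)]
  · simp
  · intro x hx
    rw [List.eq_of_mem_replicate hx]
    rfl
  · intro x hx
    rw [List.eq_of_mem_replicate hx]
    rfl

theorem readScheme_steps (a b : ℕ) (s : Bool) (r : List InSymb) :
    prog.Steps (a + b + 1) (some State.readScheme)
      (contents (List.replicate a (.inr true) ++ List.replicate b (.inr false) ++ .inl (.bit s) :: r)
        [] [] [] [] [] [] [] [] [] [] [])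
      (some (State.readIndex s))
      (contents r (List.replicate b (.inr false) ++ List.replicate (3 * a) (.inr true))
        [] [] [] [] [] [] (counter (10 * (a + b) + 10)) (counter (10 * (a + b) + 10))
        (counter (10 * (a + b) + 10)) []) := by
  have h := Steps.loop (P := prog) (q := State.readScheme)
    (l := List.replicate a (.inr true) ++ List.replicate b (.inr false)) (r := .inl (.bit s) :: r)
    (S := contents (List.replicate a (.inr true) ++ List.replicate b (.inr false) ++
      .inl (.bit s) :: r) [] [] [] [] [] [] [] [] [] [] []) rfl
    (by
      intro x hx
      simp only [List.mem_append, List.mem_replicate] at hx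
      rcases hx with ⟨-, rfl⟩ | ⟨-, rfl⟩ <;> rfl)
    (by
      intro x hx
      simp only [List.mem_append, List.mem_replicate] at hx
      rcases hx with ⟨-, rfl⟩ | ⟨-, rfl⟩ <;> rfl)
  rw [List.length_append, List.length_replicate, List.length_replicate] at h
  refine h.trans (.single rfl ?_)
  have h1 := flatMap_tenTicks (List.replicate a (Sum.inr true) ++
    List.replicate b (Sum.inr false) : List InSymb).reverse
  have h2 := flatMap_schemeWord a b
  rw [List.length_reverse, List.length_append, List.length_replicate, List.length_replicate] at h1
  funext j
  rcases j with _ | j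
  · simp [stepStacks, loopStacks, contents, src, pushSymb, ticks, only]
  · cases j <;> simp only [stepStacks, loopStacks, contents, src, pushSymb, ticks, only,
      h1, h2, Option.some.injEq, if_true, if_false, reduceCtorEq, List.append_nil, List.nil_append,
      List.head?_cons, Option.elim, schemeWord_inl, List.tail_cons, tenTicks_append,
      flatMap_const_nil]

theorem readIndex_steps (k m : ℕ) (s : Bool) (r a : List InSymb) :
    prog.Steps (k + 1) (some (State.readIndex s))
      (contents (List.replicate k (.inl (.bit true)) ++ .inl .bar :: r)
        a [] [] [] [] [] [] (counter m) (counter m) (counter m) [])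
      (some (State.readModel s))
      (contents r a (counter k) [] [] [] [] [] (counter (10 * k + m + 10))
        (counter (10 * k + m + 10)) (counter (10 * k + m + 10)) []) := by
  have h := Steps.loop (P := prog) (q := State.readIndex s)
    (l := List.replicate k (.inl (.bit true))) (r := .inl .bar :: r)
    (S := contents (List.replicate k (.inl (.bit true)) ++ .inl .bar :: r)
      a [] [] [] [] [] [] (counter m) (counter m) (counter m) []) rfl
    (by
      intro x hx
      rw [List.eq_of_mem_replicate hx]
      rfl)
    (by
      intro x hx
      rw [List.eq_of_mem_replicate hx]
      rfl)
  rw [List.length_replicate] at h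
  refine h.trans (.single rfl ?_)
  have h1 := flatMap_tenTicks (List.replicate k (Sum.inl (.bit true)) : List InSymb)
  have h2 : ((List.replicate k (Sum.inl (.bit true)) : List InSymb).flatMap fun x =>
      if x = Sum.inl .bar then [] else [tick]) = counter k := by
    rw [flatMap_of_eq_replicate (c := 1) (y := tick)]
    · simp
    · intro x hx
      rw [List.eq_of_mem_replicate hx]
      rfl
  rw [List.length_replicate] at h1
  funext j
  rcases j with _ | j
  · simp [stepStacks, loopStacks, contents, src, pushSymb, ticks, only]
  · cases j <;> simp only [stepStacks, loopStacks, contents, src, pushSymb, ticks, only,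
      h1, h2, Option.some.injEq, if_true, if_false, reduceCtorEq, List.append_nil, List.nil_append,
      List.head?_cons, Option.elim, List.tail_cons, List.reverse_replicate,
      tenTicks_append, counter_append, flatMap_const_nil]

theorem readModel_steps (m : ℕ) (s : Bool) (w : List Symb) (a k : List InSymb) :
    prog.Steps (w.length + 1) (some (State.readModel s))
      (contents (w.map .inl) a k [] [] [] [] [] (counter m) (counter m) (counter m) [])
      (some (State.splitIndex s))
      (contents [] a k [] (counter (w.count .semicolon)) (counter (w.count .semicolon))
        (w.map .inl).reverse (w.map .inl).reverse (counter (10 * w.length + m))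
        (counter (10 * w.length + m)) (counter (10 * w.length + m)) []) := by
  have h1 := flatMap_tenTicks (w.map Sum.inl : List InSymb).reverse
  rw [List.length_reverse, List.length_map] at h1
  have h := Steps.drain (P := prog) (q := State.readModel s) (l := w.map .inl)
    (S := contents (w.map .inl) a k [] [] [] [] [] (counter m) (counter m) (counter m) [])
    (q' := some (State.splitIndex s))
    (S' := contents [] a k [] (counter (w.count .semicolon)) (counter (w.count .semicolon))
        (w.map .inl).reverse (w.map .inl).reverse (counter (10 * w.length + m))
        (counter (10 * w.length + m)) (counter (10 * w.length + m)) []) rfl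
    (fun _ _ => rfl) (fun _ _ => rfl) rfl (by
      funext j
      rcases j with _ | j
      · simp [drainStacks, loopStacks, contents, src, pushSymb, ticks, only, pushEmpty]
      · cases j <;> simp only [drainStacks, loopStacks, contents, src, pushSymb, pushEmpty, ticks,
          only, h1, flatMap_semicolon, Option.some.injEq, if_true, if_false, reduceCtorEq,
          List.append_nil, List.nil_append, Option.elim, List.flatMap_singleton', counter_append,
          flatMap_const_nil])
  rwa [List.length_map] at h

/-- Each tick of the index is matched with one tick of the size. One more tick, that of the spin `k`
itself, is dropped by `skip`, which leaves the number of spins after `k`. The same step writes the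
end of the output, the leading digit of the last field onwards. -/
theorem split_steps (k n : ℕ) (s : Bool) (a k' n' w l o : List InSymb) :
    prog.Steps (2 * k + 2) (some (State.splitIndex s))
      (contents [] a (counter k) k' (counter (k + n + 1)) n' w w l l l o)
      (some (State.writeField s))
      (contents [] a [] (counter k ++ k') (counter n) n' w w l l l
        ((powEnd ++ [Symb.semicolon]).map .inl ++ o)) := by
  induction k generalizing k' with
  | zero =>
    have h1 : prog.Steps 1 (some (State.splitIndex s))
        (contents [] a (counter 0) k' (counter (0 + n + 1)) n' w w l l l o) (some (State.skip s))
        (contents [] a [] k' (counter (n + 1)) n' w w l l l o) := by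
      refine .single rfl ?_
      funext j
      rcases j with _ | j
      · simp [stepStacks, contents, src, pushEmpty, only]
      · cases j <;> simp [stepStacks, contents, src, pushEmpty, only]
    refine h1.trans (.single rfl ?_)
    funext j
    rcases j with _ | j
    · simp [stepStacks, contents, src, pushSymb, only, List.replicate_succ]
    · cases j <;> simp [stepStacks, contents, src, pushSymb, only, List.replicate_succ]
  | succ k ih =>
    rw [show 2 * (k + 1) + 2 = 1 + (1 + (2 * k + 2)) by ring]
    have h1 : prog.Steps 1 (some (State.splitIndex s))
        (contents [] a (counter (k + 1)) k' (counter (k + 1 + n + 1)) n' w w l l l o)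
        (some (State.splitSize s))
        (contents [] a (counter k) (tick :: k') (counter (k + 1 + n + 1)) n' w w l l l o) := by
      refine .single rfl ?_
      funext j
      rcases j with _ | j
      · simp [stepStacks, contents, src, pushSymb, only, List.replicate_succ]
      · cases j <;> simp [stepStacks, contents, src, pushSymb, only, List.replicate_succ]
    have h2 : prog.Steps 1 (some (State.splitSize s))
        (contents [] a (counter k) (tick :: k') (counter (k + 1 + n + 1)) n' w w l l l o)
        (some (State.splitIndex s))
        (contents [] a (counter k) (tick :: k') (counter (k + n + 1)) n' w w l l l o) := by
      refine .single rfl ?_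
      rw [show k + 1 + n + 1 = k + n + 1 + 1 by ring]
      funext j
      rcases j with _ | j
      · rfl
      · cases j <;> simp [stepStacks, contents, src, pushSymb, List.replicate_succ]
    have h3 : counter (k + 1) ++ k' = counter k ++ tick :: k' := by
      rw [counter, List.replicate_succ']
      simp
    rw [h3]
    exact h1.trans (h2.trans (ih (tick :: k')))

/-- In the state `q` the program only writes the output. -/
theorem write_steps (q : State) (f : InSymb → List InSymb) (e l : List InSymb) (S : prog.Stacks)
    (hS : S (some (src q)) = l) (hn : ∀ x, nextSymb q x = q)
    (ha : ∀ x, pushSymb q x = only none (f x)) (he : pushEmpty q = only none e) :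
    ∃ S' : prog.Stacks, prog.Steps (l.length + 1) (some q) S (nextEmpty q) S' ∧
      S' none = e ++ (l.reverse.flatMap f ++ S none) ∧
      ∀ j, j ≠ src q → S' (some j) = S (some j) := by
  refine ⟨_, Steps.drain hS (fun x _ => congrArg some (hn x)) (fun x _ => ?_) rfl rfl, ?_,
    fun j hj => ?_⟩
  · simp [ha, only]
  · simp [drainStacks, loopStacks, ha, he, only]
  · simp [drainStacks, loopStacks, ha, he, only, hj]

/-- The entries `0` of a row. -/
def zeros (m : ℕ) : List Symb := (List.replicate m entryEnd).flatten

/-- The entry `2 ^ m` of a row. -/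
def powEntry (m : ℕ) : List Symb := List.replicate m (.bit false) ++ powEnd

theorem flatMap_entryEnd (m : ℕ) :
    ((counter m).reverse.flatMap fun _ => entryEnd.map Sum.inl) =
      ((zeros m).map Sum.inl : List InSymb) := by
  rw [List.reverse_replicate, zeros]
  induction m with
  | zero => rfl
  | succ m ih => simpa [List.replicate_succ] using ih

theorem flatMap_bit_false (m : ℕ) :
    ((counter m).reverse.flatMap fun _ => [(Sum.inl (.bit false) : InSymb)]) =
      (List.replicate m (Symb.bit false)).map Sum.inl := by
  rw [List.reverse_replicate]
  induction m with
  | zero => rfl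
  | succ m ih => simpa [List.replicate_succ] using ih

/-- The output of the program, without the part in front of the models. -/
def output (k n m : ℕ) (s : Bool) (w : List Symb) : List Symb :=
  w ++ zeros (k + n + 1) ++ signWord s ++ powEntry m ++ [.semicolon, .bar] ++
    (w ++ zeros k ++ powEntry m ++ zeros n ++ signWord s ++ powEntry m ++ [.semicolon])

theorem writeAll_steps (k n m : ℕ) (s : Bool) (a : List InSymb) (w : List Symb) :
    ∃ S' : prog.Stacks, S' none = a.reverse ++ (output k n m s w).map .inl ∧
      prog.Steps (2 * k + 2 * n + 3 * m + 2 * w.length + a.length + 10) (some (State.writeField s))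
        (contents [] a [] (counter k) (counter n) (counter (k + n + 1)) (w.map .inl).reverse
          (w.map .inl).reverse (counter m) (counter m) (counter m)
          ((powEnd ++ [Symb.semicolon]).map .inl)) none S' := by
  set S := contents [] a [] (counter k) (counter n) (counter (k + n + 1)) (w.map .inl).reverse
    (w.map .inl).reverse (counter m) (counter m) (counter m)
    ((powEnd ++ [Symb.semicolon]).map .inl) with hS
  -- Nine states, each draining a stack of its own; `r₁, r₂, …` show that a stack is still intact
  -- when its turn comes. The output grows to the left.
  obtain ⟨S₁, h₁, o₁, r₁⟩ := write_steps (.writeField s) _ _ (counter m) S rfl (fun _ => rfl)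
    (fun _ => rfl) rfl
  obtain ⟨S₂, h₂, o₂, r₂⟩ := write_steps (.writeZeros s) _ _ (counter n) S₁
    (r₁ _ (by nofun)) (fun _ => rfl) (fun _ => rfl) rfl
  obtain ⟨S₃, h₃, o₃, r₃⟩ := write_steps (.writeCoupling s) _ _ (counter m) S₂
    ((r₂ _ (by nofun)).trans <| r₁ _ (by nofun)) (fun _ => rfl) (fun _ => rfl) rfl
  obtain ⟨S₄, h₄, o₄, r₄⟩ := write_steps (.writeZeros' s) _ _ (counter k) S₃
    ((r₃ _ (by nofun)).trans <| (r₂ _ (by nofun)).trans <| r₁ _ (by nofun)) (fun _ => rfl) (fun _ => rfl) rfl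
  obtain ⟨S₅, h₅, o₅, r₅⟩ := write_steps (.writeModel s) _ _ (w.map .inl).reverse S₄
    ((r₄ _ (by nofun)).trans <| (r₃ _ (by nofun)).trans <| (r₂ _ (by nofun)).trans <|
     r₁ _ (by nofun)) (fun _ => rfl) (fun _ => rfl) rfl
  obtain ⟨S₆, h₆, o₆, r₆⟩ := write_steps (.writeField' s) _ _ (counter m) S₅
    ((r₅ _ (by nofun)).trans <| (r₄ _ (by nofun)).trans <| (r₃ _ (by nofun)).trans <|
     (r₂ _ (by nofun)).trans <| r₁ _ (by nofun)) (fun _ => rfl) (fun _ => rfl) rfl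
  obtain ⟨S₇, h₇, o₇, r₇⟩ := write_steps (.writeZeros'' s) _ _ (counter (k + n + 1)) S₆
    ((r₆ _ (by nofun)).trans <| (r₅ _ (by nofun)).trans <| (r₄ _ (by nofun)).trans <|
     (r₃ _ (by nofun)).trans <| (r₂ _ (by nofun)).trans <| r₁ _ (by nofun)) (fun _ => rfl) (fun _ => rfl) rfl
  obtain ⟨S₈, h₈, o₈, r₈⟩ := write_steps (.writeModel' s) _ _ (w.map .inl).reverse S₇
    ((r₇ _ (by nofun)).trans <| (r₆ _ (by nofun)).trans <| (r₅ _ (by nofun)).trans <|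
     (r₄ _ (by nofun)).trans <| (r₃ _ (by nofun)).trans <| (r₂ _ (by nofun)).trans <|
     r₁ _ (by nofun)) (fun _ => rfl) (fun _ => rfl) rfl
  obtain ⟨S₉, h₉, o₉, -⟩ := write_steps (.writeScheme s) _ _ a S₈
    ((r₈ _ (by nofun)).trans <| (r₇ _ (by nofun)).trans <| (r₆ _ (by nofun)).trans <|
     (r₅ _ (by nofun)).trans <| (r₄ _ (by nofun)).trans <| (r₃ _ (by nofun)).trans <|
     (r₂ _ (by nofun)).trans <| r₁ _ (by nofun)) (fun _ => rfl) (fun _ => rfl) rfl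
  refine ⟨S₉, ?_, ?_⟩
  · rw [o₉, o₈, o₇, o₆, o₅, o₄, o₃, o₂, o₁]
    simp only [flatMap_entryEnd, flatMap_bit_false, List.flatMap_singleton', List.reverse_reverse]
    simp [output, powEntry, hS, contents]
  · have h := h₁.trans (h₂.trans (h₃.trans (h₄.trans (h₅.trans (h₆.trans (h₇.trans
      (h₈.trans h₉)))))))
    simp only [List.length_replicate, List.length_reverse, List.length_map] at h
    convert h using 1
    · ring
    · rfl

/-- The program computes the reduction, in linear time. -/
theorem prog_steps (a b k n : ℕ) (s : Bool) (w : List Symb) (hw : w.count .semicolon = k + n + 1) :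
    ∃ (t : ℕ) (S' : prog.Stacks), t ≤ 100 * (a + b + k + w.length + 2) ∧
      S' none = List.replicate (3 * a) (.inr true) ++ List.replicate b (.inr false) ++
        (output k n (10 * (a + b + k + w.length + 2)) s w).map .inl ∧
      prog.Steps t (some prog.start)
        (Function.update (fun _ => []) (some prog.input)
          (List.replicate a (.inr true) ++ List.replicate b (.inr false) ++
            (Symb.bit s :: List.replicate k (Symb.bit true) ++ Symb.bar :: w).map .inl)) none S' := by
  have h0 : Function.update (fun _ => []) (some prog.input)
      (List.replicate a (.inr true) ++ List.replicate b (.inr false) ++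
        (Symb.bit s :: List.replicate k (Symb.bit true) ++ Symb.bar :: w).map .inl) =
      contents (List.replicate a (.inr true) ++ List.replicate b (.inr false) ++
        .inl (.bit s) :: (List.replicate k (.inl (.bit true)) ++ .inl .bar :: w.map .inl))
        [] [] [] [] [] [] [] [] [] [] [] := by
    funext j
    rcases j with _ | j
    · rfl
    · cases j <;> simp [contents]
  have h1 := readScheme_steps a b s (List.replicate k (.inl (.bit true)) ++ .inl .bar :: w.map .inl)
  have h2 := readIndex_steps k (10 * (a + b) + 10) s (w.map .inl)
    (List.replicate b (.inr false) ++ List.replicate (3 * a) (.inr true))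
  have h3 := readModel_steps (10 * k + (10 * (a + b) + 10) + 10) s w
    (List.replicate b (.inr false) ++ List.replicate (3 * a) (.inr true)) (counter k)
  rw [hw, show 10 * w.length + (10 * k + (10 * (a + b) + 10) + 10) =
    10 * (a + b + k + w.length + 2) by ring] at h3
  have h4 := split_steps k n s (List.replicate b (.inr false) ++ List.replicate (3 * a) (.inr true))
    [] (counter (k + n + 1)) (w.map .inl).reverse (counter (10 * (a + b + k + w.length + 2))) []
  simp only [List.append_nil] at h4
  obtain ⟨S', h5, h6⟩ := writeAll_steps k n (10 * (a + b + k + w.length + 2)) s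
    (List.replicate b (.inr false) ++ List.replicate (3 * a) (.inr true)) w
  have h := h1.trans (h2.trans (h3.trans (h4.trans h6)))
  rw [h0]
  refine ⟨_, S', ?_, ?_, h⟩
  · have := List.count_le_length (a := Symb.semicolon) (l := w)
    simp only [List.length_append, List.length_replicate]
    omega
  · rw [h5]
    simp

end Reduction

/-! ### Words of numbers and models -/

/-- The least significant bit comes first, so doubling prepends a zero; zero itself, the empty word,
is an exception. -/
theorem encNat_two_mul {k : ℕ} (hk : k ≠ 0) : encNat (2 * k) = Symb.bit false :: encNat k := by
  have h : ((2 * k : ℕ) : Num) = (k : Num).bit0 := by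
    rw [← Num.bit0_of_bit0, two_mul, Nat.cast_add]
  have h' : (k : Num) ≠ 0 := by exact_mod_cast hk
  rw [encNat, encNat, Computability.encodeNat, Computability.encodeNat, h]
  cases hx : (k : Num) with
  | zero => exact absurd hx h'
  | pos p => rfl

theorem encNat_one : encNat 1 = [Symb.bit true] := rfl

theorem encNat_zero : encNat 0 = [] := rfl

theorem encNat_two_pow (m : ℕ) :
    encNat (2 ^ m) = List.replicate m (Symb.bit false) ++ [Symb.bit true] := by
  induction m with
  | zero => rfl
  | succ m ih =>
    rw [pow_succ', encNat_two_mul (by positivity), ih, List.replicate_succ, List.cons_append]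

theorem lt_two_pow_length_encNat (k : ℕ) : k < 2 ^ (encNat k).length := by
  have h : ∀ p : PosNum, (p : ℕ) < 2 ^ (Computability.encodePosNum p).length := by
    intro p
    induction p with
    | one => simp [Computability.encodePosNum]
    | bit1 p ih =>
      simp only [Computability.encodePosNum, PosNum.cast_bit1, List.length_cons, pow_succ]
      omega
    | bit0 p ih =>
      simp only [Computability.encodePosNum, PosNum.cast_bit0, List.length_cons, pow_succ]
      omega
  have h' : ∀ x : Num, (x : ℕ) < 2 ^ (Computability.encodeNum x).length := by
    intro x
    cases x with
    | zero => simp [Computability.encodeNum]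
    | pos p => exact h p
  simpa [encNat, Computability.encodeNat] using h' k

theorem encRat_zero : encRat 0 = [Symb.slash, Symb.bit true] := by
  simp [encRat, encInt, encNat_zero, encNat_one]

theorem encRat_two_pow (m : ℕ) : encRat (2 ^ m) = encNat (2 ^ m) ++ [Symb.slash, Symb.bit true] := by
  have h1 : ((2 : ℚ) ^ m).num = 2 ^ m := by simp
  have h2 : ((2 : ℚ) ^ m).den = 1 := by simp
  have h3 : ¬(2 : ℤ) ^ m < 0 := not_lt.2 (by positivity)
  simp [encRat, encInt, h1, h2, encNat_one, h3, Int.natAbs_pow]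

theorem encRat_neg_two_pow (m : ℕ) :
    encRat (-2 ^ m) = Symb.minus :: encRat (2 ^ m) := by
  have h1 : (-(2 : ℚ) ^ m).num = -2 ^ m := by simp
  have h2 : (-(2 : ℚ) ^ m).den = 1 := by simp
  rw [encRat_two_pow]
  simp [encRat, encInt, h1, h2, encNat_one, Int.natAbs_pow]

/-- The denominator is at least `1` and the numerator has at most as many bits as the word has
symbols. Thus `2` to the length of the word of a model serves as both `W` and `H`. -/
theorem abs_le_two_pow_length_encRat (q : ℚ) : |(q : ℝ)| ≤ 2 ^ (encRat q).length := by
  have h1 : |(q : ℝ)| ≤ (q.num.natAbs : ℝ) := by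
    have h : |q| ≤ (q.num.natAbs : ℚ) := by
      have hd : (1 : ℚ) ≤ q.den := by exact_mod_cast q.den_pos
      rw [Nat.cast_natAbs, Int.cast_abs]
      conv_lhs => rw [← Rat.num_div_den q, abs_div, Nat.abs_cast]
      exact div_le_self (abs_nonneg _) hd
    exact_mod_cast h
  have h2 := lt_two_pow_length_encNat q.num.natAbs
  have h3 : (encNat q.num.natAbs).length ≤ (encRat q).length := by
    simp only [encRat, encInt, List.length_append, List.length_cons]
    omega
  calc |(q : ℝ)| ≤ (q.num.natAbs : ℝ) := h1
    _ ≤ 2 ^ (encNat q.num.natAbs).length := by exact_mod_cast h2.le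
    _ ≤ 2 ^ (encRat q).length := pow_le_pow_right₀ (by norm_num) h3

theorem length_enc_le_length_encList {α : Type} (c : Symb) (enc : α → List Symb) {l : List α} {a : α}
    (h : a ∈ l) : (enc a).length ≤ (encList c enc l).length := by
  refine List.Sublist.length_le ((List.sublist_append_left (enc a) [c]).trans ?_)
  rw [encList, List.flatMap_def]
  exact List.sublist_flatten_of_mem (List.mem_map_of_mem h)

theorem encList_append {α : Type} (c : Symb) (enc : α → List Symb) (l l' : List α) :
    encList c enc (l ++ l') = encList c enc l ++ encList c enc l' :=
  List.flatMap_append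

theorem encList_singleton {α : Type} (c : Symb) (enc : α → List Symb) (a : α) :
    encList c enc [a] = enc a ++ [c] := by
  simp [encList]

/-- Every row is closed by one semicolon and contains none, so the program finds the number of spins
by counting. -/
theorem count_semicolon_word {n : ℕ} (P : IsingModel ℚ n) : P.word.count Symb.semicolon = n := by
  have h : ∀ l : List (List ℚ),
      (encList Symb.semicolon (encList Symb.comma encRat) l).count Symb.semicolon = l.length := by
    intro l
    induction l with
    | nil => rfl
    | cons r l ih =>
      have h1 : (encList Symb.comma encRat r).count Symb.semicolon = 0 :=
        List.count_eq_zero.2 fun h => (mem_row h).1 rfl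
      simp only [encList, List.flatMap_cons, List.count_append] at ih h1 ⊢
      rw [ih, h1]
      simp [Nat.add_comm]
  rw [IsingModel.word, h, IsingModel.rows, List.length_ofFn]

namespace IsingModel

variable {n : ℕ} (P : IsingModel ℚ n)

theorem le_length_word : n ≤ P.word.length := by
  conv_lhs => rw [← count_semicolon_word P]
  exact List.count_le_length

theorem abs_le_of_mem_row {r : List ℚ} {q : ℚ} (hr : r ∈ P.rows) (hq : q ∈ r) :
    |(q : ℝ)| ≤ 2 ^ P.word.length :=
  (abs_le_two_pow_length_encRat q).trans <| pow_le_pow_right₀ (by norm_num) <|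
    (length_enc_le_length_encList Symb.comma encRat hq).trans
      (length_enc_le_length_encList Symb.semicolon (encList Symb.comma encRat) hr)

theorem abs_w_le (j : Fin n) (i : Fin (j : ℕ)) : |P.toReal.w j i| ≤ 2 ^ P.word.length :=
  P.abs_le_of_mem_row (List.mem_ofFn.2 ⟨j, rfl⟩)
    (List.mem_append_left _ (List.mem_ofFn.2 ⟨i, rfl⟩))

theorem abs_h_le (j : Fin n) : |P.toReal.h j| ≤ 2 ^ P.word.length :=
  P.abs_le_of_mem_row (List.mem_ofFn.2 ⟨j, rfl⟩) (List.mem_append_right _ (by simp))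

theorem toReal_addDummy (k : Fin n) (c h₀ : ℚ) :
    (P.addDummy k c h₀).toReal = P.toReal.addDummy k (c : ℝ) (h₀ : ℝ) := by
  ext j
  · simp only [toReal, addDummy]
    split_ifs <;> simp
  · simp only [toReal, addDummy]
    split_ifs <;> simp

theorem rows_addDummy (k : Fin n) (c h₀ : ℚ) :
    (P.addDummy k c h₀).rows =
      P.rows ++ [List.ofFn (fun i : Fin n => if i = k then c else 0) ++ [h₀]] := by
  rw [rows, List.ofFn_succ', List.concat_eq_append, rows]
  congr 1
  · congr 1
    funext j
    simp [addDummy]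
  · simp [addDummy, Fin.ext_iff]

end IsingModel

theorem List.ofFn_ite_eq {α : Type} (n k m : ℕ) (hn : n = k + m + 1) (hk : k < n) (c d : α) :
    List.ofFn (fun i : Fin n => if i = ⟨k, hk⟩ then c else d) =
      List.replicate k d ++ c :: List.replicate m d := by
  subst hn
  refine List.ext_getElem (by simp; omega) fun i h1 h2 => ?_
  rw [List.getElem_ofFn]
  simp only [Fin.ext_iff, List.getElem_append, List.getElem_replicate, List.length_replicate,
    List.getElem_cons]
  split_ifs <;> first | rfl | omega

/-! ### The output of the program as the word of a TV instance. -/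

namespace Reduction

/-- The field of the new spin. -/
def field (m : ℕ) (s : ℤˣ) : ℚ := if s = 1 then -2 ^ m else 2 ^ m

theorem encList_replicate_zero (m : ℕ) :
    encList Symb.comma encRat (List.replicate m 0) = zeros m := by
  induction m with
  | zero => rfl
  | succ m ih =>
    rw [List.replicate_succ, encList, List.flatMap_cons, ← encList, ih, encRat_zero]
    simp [zeros, List.replicate_succ, entryEnd]

theorem encRat_two_pow_comma (m : ℕ) : encRat (2 ^ m) ++ [Symb.comma] = powEntry m := by
  simp [encRat_two_pow, encNat_two_pow, powEntry, powEnd, entryEnd]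

theorem encRat_field_comma (m : ℕ) (s : ℤˣ) :
    encRat (field m s) ++ [Symb.comma] = signWord (decide (s = 1)) ++ powEntry m := by
  by_cases h : s = 1
  · simp [field, h, encRat_neg_two_pow, encRat_two_pow_comma, signWord]
  · simp [field, h, encRat_two_pow_comma, signWord]

theorem tvWord_eq_output {n : ℕ} (P : IsingModel ℚ n) (k : Fin n) (s : ℤˣ) (m r : ℕ)
    (hn : n = k + r + 1) :
    tvWord ⟨n + 1, P.addDummy k 0 (field m s), P.addDummy k (2 ^ m) (field m s)⟩ =
      output k r m (decide (s = 1)) P.word := by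
  have h1 : (List.ofFn fun i : Fin n => if i = k then (0 : ℚ) else 0) = List.replicate n 0 := by
    simp
  have h2 := List.ofFn_ite_eq n k r hn k.isLt ((2 : ℚ) ^ m) 0
  have h3 := encRat_field_comma m s
  have h4 := encRat_two_pow_comma m
  rw [tvWord, IsingModel.word, IsingModel.word, IsingModel.rows_addDummy, IsingModel.rows_addDummy]
  simp only [Fin.eta] at h2
  simp only [encList_append, encList_singleton, h1, h2]
  rw [← List.singleton_append (x := (2 : ℚ) ^ m)]
  simp only [encList_append, encList_singleton, encList_replicate_zero, h3, h4, output, hn,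
    IsingModel.word]
  simp

end Reduction

/-! ### Correctness and running time of the reduction. -/

namespace Reduction

theorem length_zeros (m : ℕ) : (zeros m).length = 3 * m := by
  simp [zeros, entryEnd, mul_comm]

theorem length_output_le (k n m : ℕ) (s : Bool) (w : List Symb) :
    (output k n m s w).length ≤ 2 * w.length + 6 * (k + n) + 3 * m + 20 := by
  have h : (signWord s).length ≤ 1 := by cases s <;> simp [signWord]
  simp only [output, List.length_append, length_zeros, powEntry, powEnd, entryEnd,
    List.length_replicate, List.length_cons, List.length_nil]
  omega

theorem le_two_pow_exponent {n l a N : ℕ} (hl : n ≤ l) (hN : a + l + 2 ≤ N) :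
    ((4 : ℕ) : ℝ) * (n + 2 ^ l + 2 ^ l + 3 * a + 1) ^ 3 ≤ 2 ^ (10 * N) := by
  -- Each of `n`, `2 ^ l` and `a` is at most `2 ^ N`, so the sum is at most `8 * 2 ^ N`. Then `4 (2
  -- ^ (N + 3)) ^ 3 = 2 ^ (3 N + 11)`, and `N ≥ 2` makes the factor `10` sufficient.
  have h1 : n + 2 ^ l + 2 ^ l + 3 * a + 1 ≤ 2 ^ (N + 3) := by
    have h2 : l < 2 ^ l := Nat.lt_two_pow_self
    have h3 : a < 2 ^ a := Nat.lt_two_pow_self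
    have h4 : 2 ^ l ≤ 2 ^ N := Nat.pow_le_pow_right two_pos (by omega)
    have h5 : 2 ^ a ≤ 2 ^ N := Nat.pow_le_pow_right two_pos (by omega)
    rw [pow_add]
    omega
  have h6 : 4 * (n + 2 ^ l + 2 ^ l + 3 * a + 1) ^ 3 ≤ 2 ^ (10 * N) := by
    calc _ ≤ 4 * (2 ^ (N + 3)) ^ 3 := by gcongr
      _ = 2 ^ (2 + (N + 3) * 3) := by norm_num [pow_add 2 2, pow_mul (2 : ℕ) (N + 3)]
      _ ≤ 2 ^ (10 * N) := Nat.pow_le_pow_right two_pos (by omega)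
  exact_mod_cast h6

/-- The models that the reduction produces solve the given instance approximately. -/
theorem isMulApprox_reduction {n : ℕ} (P : IsingModel ℚ n) (k : Fin n) (s : ℤˣ) {a N : ℕ}
    (ha : 0 < a) (hN : a + P.word.length + 2 ≤ N) :
    IsMulApprox (1 / (3 * a : ℕ)) (marginalProblem ⟨n, P, k, s⟩)
      (tvProblem ⟨n + 1, P.addDummy k 0 (field (10 * N) s),
        P.addDummy k (2 ^ (10 * N)) (field (10 * N) s)⟩) := by
  have h1 := le_two_pow_exponent P.le_length_word hN
  have h2 : 1 / (1 / ((3 * a : ℕ) : ℝ)) = 3 * a := by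
    push_cast
    rw [one_div_one_div]
  simp only [tvProblem, marginalProblem, IsingModel.toReal_addDummy, Rat.cast_zero]
  refine P.toReal.isMulApprox_tvDist_addDummy k s (W := 2 ^ P.word.length)
    (H := 2 ^ P.word.length) (by positivity) P.abs_w_le P.abs_h_le (by positivity) ?_ ?_
  · rw [h2]
    refine h1.trans_eq ?_
    rcases Int.units_eq_one_or s with rfl | rfl
    · simp [field, spinVal]
    · have h3 : (-1 : ℤˣ) ≠ 1 := by decide
      simp [field, spinVal, h3]
  · rw [h2]
    exact_mod_cast h1

/-- Here `l` bounds the size parameter of the call to the given machine, so `l ≤ 100 v` and `2 t ≤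
400 v`; the exponent `d + 1` also covers the linear term when `d = 0`. -/
theorem poly_time_bound {C d t T N l : ℕ} {v : ℝ} (hv : 1 ≤ v) (hN : (N : ℝ) ≤ 2 * v)
    (hl : l ≤ 50 * N) (ht : t ≤ 100 * N) (hT : (T : ℝ) ≤ C * (l : ℝ) ^ d) :
    ((2 * t + T : ℕ) : ℝ) ≤ ((C * 100 ^ d + 400 : ℕ) : ℝ) * v ^ (d + 1) := by
  have hl' : (l : ℝ) ≤ 50 * N := by exact_mod_cast hl
  have ht' : (t : ℝ) ≤ 100 * N := by exact_mod_cast ht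
  have h1 : v ^ d ≤ v ^ (d + 1) := pow_le_pow_right₀ hv (Nat.le_succ d)
  have h2 : v ≤ v ^ (d + 1) := le_self_pow₀ hv (Nat.succ_ne_zero d)
  have h3 : (l : ℝ) ^ d ≤ 100 ^ d * v ^ (d + 1) :=
    calc (l : ℝ) ^ d ≤ (100 * v) ^ d := by
          gcongr
          linarith
      _ = 100 ^ d * v ^ d := mul_pow _ _ _
      _ ≤ 100 ^ d * v ^ (d + 1) := by gcongr
  have h4 : (C : ℝ) * (l : ℝ) ^ d ≤ C * (100 ^ d * v ^ (d + 1)) := by gcongr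
  push_cast
  linarith

theorem hasFPRAS_marginalProblem (h : HasFPRAS tvEncoding tvProblem) :
    HasFPRAS marginalEncoding marginalProblem := by
  obtain ⟨M, inp, out, C, d, hM⟩ := h
  refine ⟨ProbTM.precomp prog M inp, ProbTM.precompInp prog M inp, out, C * 100 ^ d + 400, d + 1, ?_⟩
  rintro ⟨n, P, k, s⟩ ε δ hε hδ
  set a := ⌈1 / ε⌉₊ with ha
  set b := ⌈1 / δ⌉₊ with hb
  have ha0 : 0 < a := Nat.ceil_pos.2 (by positivity)
  have hb0 : 0 < b := Nat.ceil_pos.2 (by positivity)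
  obtain ⟨r, hr⟩ : ∃ r, n = k + r + 1 := ⟨n - 1 - k, by omega⟩
  set N := a + b + k + P.word.length + 2 with hN
  set inst : TVInstance := ⟨n + 1, P.addDummy k 0 (field (10 * N) s),
    P.addDummy k (2 ^ (10 * N)) (field (10 * N) s)⟩ with hinst
  have hword : tvEncoding.encode inst = output k r (10 * N) (decide (s = 1)) P.word :=
    tvWord_eq_output P k s (10 * N) r hr
  -- Reciprocals of integers are chosen so that the ceilings in the input word are exactly `3 a` and
  -- `b`.
  obtain ⟨T, hT, hhalt, hprob⟩ := hM inst (1 / (3 * a : ℕ)) (1 / b) (by positivity) (by positivity)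
  have hscheme : schemeInput (1 / (3 * a : ℕ)) (1 / b) (tvEncoding.encode inst) =
      List.replicate (3 * a) (.inr true) ++ List.replicate b (.inr false) ++
        (output k r (10 * N) (decide (s = 1)) P.word).map .inl := by
    rw [hword, schemeInput, one_div_one_div, one_div_one_div, Nat.ceil_natCast, Nat.ceil_natCast]
  obtain ⟨t, S', ht, hS', hsteps⟩ := prog_steps a b k r (decide (s = 1)) P.word
    ((count_semicolon_word P).trans hr)
  obtain ⟨o, X, hrun⟩ := ProbTM.run_precomp (inp := inp) hsteps (hS'.trans hscheme.symm)
  have hinput : (schemeInput ε δ (marginalEncoding.encode ⟨n, P, k, s⟩)).map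
      (ProbTM.precompInp prog M inp).symm =
      List.replicate a (.inr true) ++ List.replicate b (.inr false) ++
        (Symb.bit (decide (s = 1)) :: List.replicate k (Symb.bit true) ++
          Symb.bar :: P.word).map .inl :=
    List.map_id _
  have hrun' := (congrArg (fun l => (ProbTM.precomp prog M inp).run (2 * t + T)
    (Turing.initList (ProbTM.precomp prog M inp).toFinTM2 l)) hinput).trans (hrun T)
  have hlen : (marginalEncoding.encode ⟨n, P, k, s⟩).length = k + P.word.length + 2 := by
    change (marginalWord ⟨n, P, k, s⟩).length = _
    simp [marginalWord]
    ring
  have ha1 := Nat.ceil_lt_add_one (a := 1 / ε) (by positivity)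
  have hb1 := Nat.ceil_lt_add_one (a := 1 / δ) (by positivity)
  rw [← ha] at ha1
  rw [← hb] at hb1
  refine ⟨2 * t + T, ?_, ?_, ?_⟩
  · have hε' : 0 < 1 / ε := by positivity
    have hδ' : 0 < 1 / δ := by positivity
    have hl := length_output_le k r (10 * N) (decide (s = 1)) P.word
    have hn := P.le_length_word
    rw [hlen]
    refine poly_time_bound (N := N) (l := (tvEncoding.encode inst).length + 3 * a + b + 1)
      ?_ ?_ ?_ ht ?_
    · push_cast
      linarith [(k : ℕ).cast_nonneg (α := ℝ), P.word.length.cast_nonneg (α := ℝ)]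
    · rw [hN]
      push_cast
      linarith [(k : ℕ).cast_nonneg (α := ℝ), P.word.length.cast_nonneg (α := ℝ)]
    · rw [hword]
      omega
    · rw [one_div_one_div, one_div_one_div] at hT
      exact_mod_cast hT
  · intro c hc
    obtain ⟨c', hc', rfl⟩ := (PMF.mem_support_map_iff _ _ _).1 (hrun' ▸ hc)
    exact congrArg (Option.map Sum.inl) (hhalt c' hc')
  · have hbδ : 1 / (b : ℝ) ≤ δ := by
      rw [one_div_le (by positivity) hδ]
      exact Nat.le_ceil _
    have haε : 1 / (a : ℝ) ≤ ε := by
      rw [one_div_le (by positivity) hε]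
      exact Nat.le_ceil _
    -- The failure probability `1 / b` is at most `δ`, and the lift of a configuration keeps the
    -- output stack of the given machine.
    refine (ENNReal.ofReal_le_ofReal (by linarith)).trans (hprob.trans ?_)
    refine le_trans ?_ (congrArg (fun p : PMF _ => p.toOuterMeasure _) hrun').ge
    rw [PMF.toOuterMeasure_map_apply]
    refine MeasureTheory.measure_mono ?_
    rintro c ⟨m, z, hc, hv⟩
    refine ⟨m, z, hc, ?_⟩
    refine (isMulApprox_reduction P k s ha0 (by omega : a + P.word.length + 2 ≤ N)).trans hv
      (P.toReal.marginal_nonneg k s) (by positivity) ?_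
    -- With `x = 1 / a ≤ 1`, the two errors combine to `(1 + x / 3) ^ 2 ≤ 1 + x ≤ 1 + ε`.
    have h1 : (1 : ℝ) / (3 * a : ℕ) = 1 / a / 3 := by
      push_cast
      rw [mul_comm, div_div]
    have h2 : 1 / (a : ℝ) ≤ 1 := by
      rw [div_le_one (by positivity)]
      exact_mod_cast ha0
    have h3 : 0 < 1 / (a : ℝ) := by positivity
    rw [h1]
    nlinarith

end Reduction

end

/-- An FPRAS for the TV distance between Ising models yields an FPRAS for the atomic marginals.
Moreover, adding to `P` a dummy spin with a strong field `h₀` of the sign opposite to `s`, once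
uncoupled and once coupled to the spin `k` with a large coupling `δ`, gives two models whose TV
distance is an `ε`-multiplicative approximation of `Pr_P[x_k = s]`; it suffices that `|h₀|` and
`δ` exceed a fixed polynomial in the number of spins, the size of the parameters and `1/ε`. -/
theorem mainTheorem3 :
    (HasFPRAS tvEncoding tvProblem → HasFPRAS marginalEncoding marginalProblem) ∧
    ∃ C d : ℕ, ∀ (n : ℕ) (P : IsingModel ℝ n) (k : Fin n) (s : ℤˣ) (W H ε h₀ δ : ℝ),
      0 ≤ W → (∀ j i, |P.w j i| ≤ W) → (∀ j, |P.h j| ≤ H) → 0 < ε →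
      (C : ℝ) * (n + W + H + 1 / ε + 1) ^ d ≤ -(spinVal s * h₀) →
      (C : ℝ) * (n + W + H + 1 / ε + 1) ^ d ≤ δ →
      IsMulApprox ε (P.marginal k s) ((P.addDummy k 0 h₀).tvDist (P.addDummy k δ h₀)) :=
  ⟨Reduction.hasFPRAS_marginalProblem, 4, 3, fun _ P k s _ _ _ _ _ hW hw hh hε h₁ h₂ =>
    P.isMulApprox_tvDist_addDummy k s hW hw hh hε h₁ h₂⟩
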